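/- Let $d\ge 1$, let $\sigma,\bar\alpha$ be real $d\times d$ matrices, and let $\lambda^{i,j}\ge 0$, $0\le i,j\le d$, be real numbers with $\lambda^{i,i}=0$. For a vector $p=(p_1,\dots,p_d)\in\mathbb R^d$ put $p_0:=0$, and set $$C:=\{\rho\in\mathbb R^d:\ -\lambda^{j,i}\le \rho_i-\rho_j\le\lambda^{i,j},\ 0\le i,j\le d\},\qquad \delta_C(\rho):=\sup_{u\in C}u\cdot\rho .$$ For $a\in\mathbb R$ consider the first corrector equation with eigenvalue $a$ on $\mathbb R^d$, $$\max_{0\le i\ne j\le d}\ \max\Big\{-\frac{|\sigma\rho|^2}{2}-\frac12\mathrm{Tr}\big[\bar\alpha\bar\alpha^{T}D^2\bar w(\rho)\big]+a\ ;\ -\lambda^{i,j}+\frac{\partial\bar w}{\partial\rho_i}(\rho)-\frac{\partial\bar w}{\partial\rho_j}(\rho)\Big\}=0,\qquad \frac{\partial \bar w}{\partial\rho_0}:=0. \tag{1}$$ A viscosity solution of (1) is a locally bounded function $\bar w:\mathbb R^d\to\mathbb R$ (not necessarily continuous) whose upper semicontinuous envelope is a viscosity subsolution and whose lower semicontinuous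 envelope is a viscosity supersolution of (1), in the usual sense of $C^2$ test functions. Then there is at most one constant $a\in\mathbb R$ for which (1) has a viscosity solution $\bar w$ with $\bar w(\rho)/\delta_C(\rho)\to 1$ as $|\rho|\to\infty$ (a condition that includes $\delta_C(\rho)\ne0$ for $|\rho|$ large). -/

import Mathlib

open Filter Topology

noncomputable section

namespace Corrector

/-- `ℝ^d` with the Euclidean norm and scalar product. -/
abbrev E (d : ℕ) : Type := EuclideanSpace ℝ (Fin d)

/-- The vector `(p_0, p_1, …, p_d)` obtained from `p = (p_1, …, p_d)` by the convention `p_0 = 0`. -/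
def ext0 {d : ℕ} (p : E d) : Fin (d + 1) → ℝ :=
  Fin.cons 0 (fun i : Fin d => p i)

/-- The convex polyhedron
`C = {ρ : -λ^{j,i} ≤ ρ_i - ρ_j ≤ λ^{i,j} for all 0 ≤ i, j ≤ d}`, where `ρ_0 = 0`. -/
def polyC {d : ℕ} (lam : Matrix (Fin (d + 1)) (Fin (d + 1)) ℝ) : Set (E d) :=
  {ρ | ∀ i j, -lam j i ≤ ext0 ρ i - ext0 ρ j ∧ ext0 ρ i - ext0 ρ j ≤ lam i j}

/-- The support function `δ_C(ρ) = sup_{u ∈ C} u · ρ`. -/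
def deltaC {d : ℕ} (lam : Matrix (Fin (d + 1)) (Fin (d + 1)) ℝ) (ρ : E d) : ℝ :=
  sSup ((fun u : E d => inner ℝ u ρ) '' polyC lam)

/-- The operator of the first corrector equation with eigenvalue `a`, at the point `ρ`, for the
gradient `p` and the Hessian `X`: the maximum of the number
`-|σρ|²/2 - Tr(α αᵀ X)/2 + a` and of all the numbers `-λ^{i,j} + p_i - p_j`,
`0 ≤ i ≠ j ≤ d`, where `p_0 = 0`. -/
def correctorOp {d : ℕ} (lam : Matrix (Fin (d + 1)) (Fin (d + 1)) ℝ)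
    (σ α : Matrix (Fin d) (Fin d) ℝ) (a : ℝ)
    (ρ p : E d) (X : Matrix (Fin d) (Fin d) ℝ) : ℝ :=
  (Finset.univ.filter (fun ij : Fin (d + 1) × Fin (d + 1) => ij.1 ≠ ij.2)).fold max
    (-(‖Matrix.toEuclideanLin σ ρ‖ ^ 2 / 2) - (α * α.transpose * X).trace / 2 + a)
    (fun ij => -lam ij.1 ij.2 + ext0 p ij.1 - ext0 p ij.2)

/-- The Hessian matrix of `φ` at `x`. -/
def hessian {d : ℕ} (φ : E d → ℝ) (x : E d) : Matrix (Fin d) (Fin d) ℝ :=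
  Matrix.of fun i j =>
    fderiv ℝ (fderiv ℝ φ) x (EuclideanSpace.single i 1) (EuclideanSpace.single j 1)

/-- Upper semicontinuous viscosity subsolutions of `F(ρ, Du, D²u) = 0` on `ℝ^d`. -/
def IsViscositySubsolution {d : ℕ} (F : E d → E d → Matrix (Fin d) (Fin d) ℝ → ℝ)
    (u : E d → ℝ) : Prop :=
  UpperSemicontinuous u ∧
    ∀ (φ : E d → ℝ) (x : E d), ContDiff ℝ 2 φ → IsLocalMax (fun y => u y - φ y) x →
      F x (gradient φ x) (hessian φ x) ≤ 0

/-- Lower semicontinuous viscosity supersolutions of `F(ρ, Du, D²u) = 0` on `ℝ^d`. -/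
def IsViscositySupersolution {d : ℕ} (F : E d → E d → Matrix (Fin d) (Fin d) ℝ → ℝ)
    (u : E d → ℝ) : Prop :=
  LowerSemicontinuous u ∧
    ∀ (φ : E d → ℝ) (x : E d), ContDiff ℝ 2 φ → IsLocalMin (fun y => u y - φ y) x →
      0 ≤ F x (gradient φ x) (hessian φ x)

/-- Locally bounded functions. -/
def LocBdd {d : ℕ} (w : E d → ℝ) : Prop :=
  ∀ x, ∃ M : ℝ, ∀ᶠ y in 𝓝 x, |w y| ≤ M

/-- The upper semicontinuous envelope `w^*` (the point itself is included in the limsup). -/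
def upperEnv {d : ℕ} (w : E d → ℝ) (x : E d) : ℝ := limsup w (𝓝 x)

/-- The lower semicontinuous envelope `w_*`. -/
def lowerEnv {d : ℕ} (w : E d → ℝ) (x : E d) : ℝ := liminf w (𝓝 x)

/-- Viscosity solutions of `F(ρ, Dw, D²w) = 0` on `ℝ^d`: locally bounded functions `w` such that
`w^*` is a subsolution and `w_*` is a supersolution. For continuous `w` one has `w^* = w_* = w`. -/
def IsViscositySolution {d : ℕ} (F : E d → E d → Matrix (Fin d) (Fin d) ℝ → ℝ)
    (w : E d → ℝ) : Prop :=
  LocBdd w ∧ IsViscositySubsolution F (upperEnv w) ∧ IsViscositySupersolution F (lowerEnv w)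

end Corrector

end

/-! ### The two cases of the operator, and the edge directions `e_i - e_j`. -/

namespace Corrector

variable {d : ℕ}

/-! By symmetry it suffices to prove `a₁ ≤ a₂` (`eigenvalue_le`). Let `U` be the upper envelope of
`w₁`. If `U` were `C²`, then for `τ < 1` the function `τU` would grow strictly slower than the lower
envelope of `w₂`, so `τU - w₂_*` would have a maximum point, where `τU` is a test function for the
supersolution. Since `DU` lies in `C` and all costs are positive, `τDU` satisfies every gradient
constraint strictly. The supersolution must therefore satisfy its diffusion inequality, which gives
`τ a₁ ≤ a₂`; then `τ → 1`.

The work is to replace `U` by a smooth subsolution with eigenvalue `a₁ - ε`, by averaging instead of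
doubling variables. In integrated form the gradient constraint reads `U(x + e) ≤ U(x) + δ_C(e)`
(`le_add_deltaC_of_viscosity`); it makes `U` Lipschitz and survives averaging over translates. Let
`g ≥ U` be a mollification close to `U`, and let `P` be the transition operator of a random walk
along the columns of `α`, so that `P - 1` approximates `r²/d` times the generator. Comparison over a
short time `T = n r²/d` gives `U ≤ Pⁿg + T(|σx|²/2 - a₁)` up to errors (`le_walkOp_iterate`). For
the Cesàro mean `W` of `g, Pg, …, Pⁿ⁻¹g`, telescoping gives `PW - W = (Pⁿg - g)/n`; dividing by the
time step bounds the generator of `W` below by `a₁ - ε - |σx|²/2` (`exists_smooth_subsolution`). -/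

theorem correctorOp_nonpos_iff {lam : Matrix (Fin (d + 1)) (Fin (d + 1)) ℝ}
    {σ α : Matrix (Fin d) (Fin d) ℝ} {a : ℝ} {ρ p : E d} {X : Matrix (Fin d) (Fin d) ℝ} :
    correctorOp lam σ α a ρ p X ≤ 0 ↔
      a ≤ ‖Matrix.toEuclideanLin σ ρ‖ ^ 2 / 2 + (α * α.transpose * X).trace / 2 ∧
        ∀ i j, i ≠ j → ext0 p i - ext0 p j ≤ lam i j := by
  unfold correctorOp
  rw [Finset.fold_max_le]
  simp only [Finset.mem_filter, Finset.mem_univ, true_and, Prod.forall]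
  refine and_congr ⟨fun h => by linarith, fun h => by linarith⟩ ?_
  refine forall_congr' fun i => forall_congr' fun j => imp_congr_right fun _ => ?_
  exact ⟨fun h => by linarith, fun h => by linarith⟩

theorem correctorOp_nonneg_iff {lam : Matrix (Fin (d + 1)) (Fin (d + 1)) ℝ}
    {σ α : Matrix (Fin d) (Fin d) ℝ} {a : ℝ} {ρ p : E d} {X : Matrix (Fin d) (Fin d) ℝ} :
    0 ≤ correctorOp lam σ α a ρ p X ↔
      ‖Matrix.toEuclideanLin σ ρ‖ ^ 2 / 2 + (α * α.transpose * X).trace / 2 ≤ a ∨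
        ∃ i j, i ≠ j ∧ lam i j ≤ ext0 p i - ext0 p j := by
  unfold correctorOp
  rw [Finset.le_fold_max]
  simp only [Finset.mem_filter, Finset.mem_univ, true_and, Prod.exists]
  refine or_congr ⟨fun h => by linarith, fun h => by linarith⟩ ?_
  refine exists_congr fun i => exists_congr fun j => and_congr_right fun _ => ?_
  exact ⟨fun h => by linarith, fun h => by linarith⟩

/-- The vector `e_i - e_j`, where `e_0 = 0`. -/
def edge (i j : Fin (d + 1)) : E d :=
  WithLp.toLp 2 fun k => (if k.succ = i then 1 else 0) - (if k.succ = j then 1 else 0)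

theorem ext0_eq_sum (p : E d) (i : Fin (d + 1)) :
    ext0 p i = ∑ k : Fin d, (if k.succ = i then p k else 0) := by
  refine Fin.cases ?_ (fun k => ?_) i
  · simp [ext0]
  · simp [ext0]

theorem inner_edge (i j : Fin (d + 1)) (p : E d) :
    inner ℝ (edge i j) p = ext0 p i - ext0 p j := by
  rw [ext0_eq_sum, ext0_eq_sum, ← Finset.sum_sub_distrib, PiLp.inner_apply]
  refine Finset.sum_congr rfl fun k _ => ?_
  simp only [edge, RCLike.inner_apply, conj_trivial]
  split_ifs <;> simp

theorem edge_ne_zero {i j : Fin (d + 1)} (hij : i ≠ j) : (edge i j : E d) ≠ 0 := by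
  intro h
  have h1 := fun k => congrArg (fun v : E d => v k) h
  simp only [edge, PiLp.zero_apply] at h1
  rcases Fin.eq_zero_or_eq_succ i with hi | ⟨k, hk⟩
  · rcases Fin.eq_zero_or_eq_succ j with hj | ⟨k, hk⟩
    · exact hij (hi.trans hj.symm)
    · have := h1 k
      rw [hi, hk] at this
      simp [Fin.succ_ne_zero] at this
  · have := h1 k
    rw [← hk] at this
    simp [hij] at this

/-! ### The polyhedron `C` and its support function. -/

variable {lam : Matrix (Fin (d + 1)) (Fin (d + 1)) ℝ}

theorem mem_polyC_of_le (hlam : ∀ i j, 0 ≤ lam i j) {p : E d}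
    (h : ∀ i j, i ≠ j → ext0 p i - ext0 p j ≤ lam i j) : p ∈ polyC lam := by
  have h' : ∀ i j, ext0 p i - ext0 p j ≤ lam i j := by
    intro i j
    by_cases hij : i = j
    · subst hij; simpa using hlam i i
    · exact h i j hij
  exact fun i j => ⟨by linarith [h' j i], h' i j⟩

theorem zero_mem_polyC (hlam : ∀ i j, 0 ≤ lam i j) : (0 : E d) ∈ polyC lam :=
  mem_polyC_of_le hlam fun i j _ => by simpa [← inner_edge] using hlam i j

theorem exists_norm_le_of_mem_polyC (lam : Matrix (Fin (d + 1)) (Fin (d + 1)) ℝ) :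
    ∃ M : ℝ, 0 ≤ M ∧ ∀ p : E d, p ∈ polyC lam → ‖p‖ ≤ M := by
  refine ⟨√(∑ k : Fin d, (max (lam k.succ 0) (lam 0 k.succ)) ^ 2), Real.sqrt_nonneg _,
    fun p hp => ?_⟩
  rw [EuclideanSpace.norm_eq]
  refine Real.sqrt_le_sqrt (Finset.sum_le_sum fun k _ => ?_)
  have h := hp k.succ 0
  simp only [ext0, Fin.cons_succ, Fin.cons_zero, sub_zero] at h
  refine pow_le_pow_left₀ (norm_nonneg _) ?_ 2
  rw [Real.norm_eq_abs, abs_le]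
  exact ⟨by linarith [le_max_right (lam k.succ 0) (lam 0 k.succ)],
    by linarith [le_max_left (lam k.succ 0) (lam 0 k.succ)]⟩

theorem bddAbove_inner_polyC (lam : Matrix (Fin (d + 1)) (Fin (d + 1)) ℝ) (ρ : E d) :
    BddAbove ((fun u : E d => inner ℝ u ρ) '' polyC lam) := by
  obtain ⟨M, -, hM⟩ := exists_norm_le_of_mem_polyC lam
  refine ⟨M * ‖ρ‖, ?_⟩
  rintro _ ⟨u, hu, rfl⟩
  exact (real_inner_le_norm _ _).trans (mul_le_mul_of_nonneg_right (hM u hu) (norm_nonneg _))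

theorem inner_le_deltaC {u : E d} (hu : u ∈ polyC lam) (ρ : E d) :
    inner ℝ u ρ ≤ deltaC lam ρ :=
  le_csSup (bddAbove_inner_polyC lam ρ) ⟨u, hu, rfl⟩

theorem deltaC_le (hlam : ∀ i j, 0 ≤ lam i j) {ρ : E d} {c : ℝ}
    (h : ∀ u ∈ polyC lam, inner ℝ u ρ ≤ c) : deltaC lam ρ ≤ c := by
  refine csSup_le ⟨_, 0, zero_mem_polyC hlam, rfl⟩ ?_
  rintro _ ⟨u, hu, rfl⟩
  exact h u hu

theorem deltaC_nonneg (hlam : ∀ i j, 0 ≤ lam i j) (ρ : E d) : 0 ≤ deltaC lam ρ := by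
  simpa using inner_le_deltaC (zero_mem_polyC hlam) ρ

theorem exists_deltaC_le_mul_norm (hlam : ∀ i j, 0 ≤ lam i j) :
    ∃ M : ℝ, 0 ≤ M ∧ ∀ ρ : E d, deltaC lam ρ ≤ M * ‖ρ‖ := by
  obtain ⟨M, h0, hM⟩ := exists_norm_le_of_mem_polyC lam
  exact ⟨M, h0, fun ρ => deltaC_le hlam fun u hu =>
    (real_inner_le_norm _ _).trans (mul_le_mul_of_nonneg_right (hM u hu) (norm_nonneg _))⟩

/-- Pairing with an edge is exactly a defining inequality of `C`. This both forces positive costs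
and turns growth by `δ_C` back into the edgewise gradient constraint. -/
theorem deltaC_smul_edge_le (hlam : ∀ i j, 0 ≤ lam i j) {s : ℝ} (hs : 0 ≤ s)
    (i j : Fin (d + 1)) : deltaC lam (s • edge i j) ≤ s * lam i j := by
  refine deltaC_le hlam fun u hu => ?_
  rw [real_inner_smul_right, real_inner_comm, inner_edge]
  exact mul_le_mul_of_nonneg_left (hu i j).2 hs

theorem continuous_deltaC (hlam : ∀ i j, 0 ≤ lam i j) : Continuous (deltaC lam) := by
  obtain ⟨M, h0, hM⟩ := exists_norm_le_of_mem_polyC lam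
  refine (LipschitzWith.of_le_add_mul ⟨M, h0⟩ fun x y => deltaC_le hlam fun u hu => ?_).continuous
  have h1 := inner_le_deltaC hu y
  have h2 : inner ℝ u (x - y) ≤ M * ‖x - y‖ :=
    (real_inner_le_norm _ _).trans (mul_le_mul_of_nonneg_right (hM u hu) (norm_nonneg _))
  rw [inner_sub_right] at h2
  rw [dist_eq_norm]
  change _ ≤ _ + M * _
  linarith

/-- If the support function does not vanish near infinity, then all the costs are positive. -/
theorem lam_pos_of_eventually_deltaC_ne_zero (hlam : ∀ i j, 0 ≤ lam i j)
    (h : ∀ᶠ ρ in Bornology.cobounded (E d), deltaC lam ρ ≠ 0) {i j : Fin (d + 1)} (hij : i ≠ j) :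
    0 < lam i j := by
  obtain ⟨R, -, hR⟩ := (Filter.hasBasis_cobounded_norm.eventually_iff).1 h
  have he : 0 < ‖(edge i j : E d)‖ := norm_pos_iff.2 (edge_ne_zero hij)
  set s : ℝ := |R| / ‖(edge i j : E d)‖ with hs
  have hs0 : 0 ≤ s := by positivity
  have h1 : deltaC lam (s • edge i j) ≠ 0 := by
    apply hR
    simp only [Set.mem_ofPred_eq]
    rw [norm_smul, Real.norm_of_nonneg hs0, hs, div_mul_cancel₀ _ he.ne']
    exact le_abs_self R
  have h2 := deltaC_smul_edge_le hlam hs0 i j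
  have h3 := (deltaC_nonneg hlam (s • edge i j)).lt_of_ne' h1
  exact pos_of_mul_pos_right (h3.trans_le h2) hs0

/-- If `m` bounds all off-diagonal costs from below, any vector with coordinates at most `m / 2` in
absolute value lies in `C`; pairing `ρ` with its own multiple of norm `m / 2` gives the bound. -/
theorem exists_mul_norm_le_deltaC (hpos : ∀ i j, i ≠ j → 0 < lam i j)
    (hlam : ∀ i j, 0 ≤ lam i j) :
    ∃ m : ℝ, 0 < m ∧ ∀ ρ : E d, m * ‖ρ‖ ≤ deltaC lam ρ := by
  obtain ⟨m, hm, hml⟩ : ∃ m : ℝ, 0 < m ∧ ∀ i j, i ≠ j → m ≤ lam i j := by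
    have : ∀ q : Fin (d + 1) × Fin (d + 1), ∃ m : ℝ, 0 < m ∧ (q.1 ≠ q.2 → m ≤ lam q.1 q.2) := by
      intro q
      by_cases hq : q.1 = q.2
      -- Diagonal pairs carry no constraint; any positive value keeps the finite minimum positive.
      · exact ⟨1, one_pos, fun h => absurd hq h⟩
      · exact ⟨lam q.1 q.2, hpos _ _ hq, fun _ => le_rfl⟩
    choose f hf hf' using this
    refine ⟨Finset.univ.inf' Finset.univ_nonempty f, ?_, fun i j hij => ?_⟩
    · exact (Finset.lt_inf'_iff _).2 fun q _ => hf q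
    · exact (Finset.inf'_le f (Finset.mem_univ (i, j))).trans (hf' (i, j) hij)
  refine ⟨m / 2, by positivity, fun ρ => ?_⟩
  rcases eq_or_ne ρ 0 with rfl | hρ
  · simpa using deltaC_nonneg hlam 0
  have hρ' : 0 < ‖ρ‖ := norm_pos_iff.2 hρ
  have hmem : ((m / 2) / ‖ρ‖) • ρ ∈ polyC lam := by
    have hcoord : ∀ k : Fin (d + 1), |ext0 (((m / 2) / ‖ρ‖) • ρ) k| ≤ m / 2 := by
      intro k
      refine Fin.cases ?_ (fun k => ?_) k
      · simpa [ext0] using (half_pos hm).le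
      · simp only [ext0, Fin.cons_succ, PiLp.smul_apply, smul_eq_mul]
        have : |ρ k| ≤ ‖ρ‖ := by simpa using PiLp.norm_apply_le ρ k
        rw [abs_mul, abs_of_nonneg (by positivity), div_mul_eq_mul_div, div_le_iff₀ hρ']
        exact mul_le_mul_of_nonneg_left this (by positivity)
    refine mem_polyC_of_le hlam fun i j hij => ?_
    have h1 := abs_le.1 (hcoord i)
    have h2 := abs_le.1 (hcoord j)
    linarith [hml i j hij]
  have h := inner_le_deltaC hmem ρ
  rw [real_inner_smul_left, real_inner_self_eq_norm_sq] at h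
  calc m / 2 * ‖ρ‖ = m / 2 / ‖ρ‖ * ‖ρ‖ ^ 2 := by field_simp
    _ ≤ _ := h

/-! ### Envelopes and attainment of maxima. -/

theorem LocBdd.exists_forall_norm_le {w : E d → ℝ} (hw : LocBdd w) (R : ℝ) :
    ∃ M : ℝ, ∀ x, ‖x‖ ≤ R → |w x| ≤ M := by
  have hc : IsCompact (Metric.closedBall (0 : E d) R) := isCompact_closedBall _ _
  obtain ⟨M, hM⟩ := hc.induction_on (p := fun s => ∃ M : ℝ, ∀ x ∈ s, |w x| ≤ M)
    ⟨0, by simp⟩ (fun s t hst ⟨M, hM⟩ => ⟨M, fun x hx => hM x (hst hx)⟩)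
    (fun s t ⟨M, hM⟩ ⟨N, hN⟩ => ⟨max M N, fun x hx => hx.elim
      (fun h => (hM x h).trans (le_max_left _ _)) fun h => (hN x h).trans (le_max_right _ _)⟩)
    (fun x _ => (hw x).elim fun M hM => ⟨_, mem_nhdsWithin_of_mem_nhds hM, M, fun y hy => hy⟩)
  exact ⟨M, fun x hx => hM x (by simpa using hx)⟩

theorem upperEnv_le_of_le {w φ : E d → ℝ} (hw : LocBdd w) (hφ : Continuous φ)
    (h : ∀ x, w x ≤ φ x) (x : E d) : upperEnv w x ≤ φ x := by
  obtain ⟨M, hM⟩ := hw x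
  refine le_of_forall_pos_le_add fun ε hε => ?_
  refine limsup_le_of_le ?_ ?_
  · exact IsBoundedUnder.isCoboundedUnder_le ⟨-M, hM.mono fun y hy => (abs_le.1 hy).1⟩
  · filter_upwards [hφ.continuousAt.eventually (eventually_lt_nhds (lt_add_of_pos_right (φ x) hε))]
      with y hy using (h y).trans hy.le

theorem le_lowerEnv_of_le {w φ : E d → ℝ} (hw : LocBdd w) (hφ : Continuous φ)
    (h : ∀ x, φ x ≤ w x) (x : E d) : φ x ≤ lowerEnv w x := by
  obtain ⟨M, hM⟩ := hw x
  refine le_of_forall_sub_le fun ε hε => ?_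
  refine le_liminf_of_le ?_ ?_
  · exact IsBoundedUnder.isCoboundedUnder_ge ⟨M, hM.mono fun y hy => (abs_le.1 hy).2⟩
  · filter_upwards [hφ.continuousAt.eventually (eventually_gt_nhds (sub_lt_self (φ x) hε))]
      with y hy using hy.le.trans (h y)

/-- Attainment of the maximum of an upper semicontinuous function on a closed set. -/
theorem exists_isMaxOn_of_coercive {Φ : E d → ℝ} (hΦ : UpperSemicontinuous Φ) {s : Set (E d)}
    (hs : IsClosed s) {x₀ : E d} (hx₀ : x₀ ∈ s) {R : ℝ}
    (hR : ∀ x ∈ s, R ≤ ‖x‖ → Φ x ≤ Φ x₀) : ∃ x ∈ s, IsMaxOn Φ s x := by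
  have hc : IsCompact (s ∩ Metric.closedBall 0 (max R ‖x₀‖)) :=
    (isCompact_closedBall _ _).inter_left hs
  have hx₀' : x₀ ∈ s ∩ Metric.closedBall 0 (max R ‖x₀‖) := ⟨hx₀, by simp⟩
  obtain ⟨x, hx, hmax⟩ := (hΦ.upperSemicontinuousOn _).exists_isMaxOn ⟨x₀, hx₀'⟩ hc
  refine ⟨x, hx.1, fun y hy => ?_⟩
  by_cases hyR : ‖y‖ ≤ max R ‖x₀‖
  · exact hmax ⟨hy, by simpa using hyR⟩
  · exact (hR y hy ((le_max_left _ _).trans (not_le.1 hyR).le)).trans (hmax hx₀')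

/-- A quadratic penalty dominates linear growth. -/
theorem exists_forall_add_mul_sub_sq_le (A B b : ℝ) {c : ℝ} (hc : 0 < c) :
    ∃ R : ℝ, ∀ t : ℝ, R ≤ t → A + B * t - c * t ^ 2 ≤ b := by
  refine ⟨|B| / c + |A - b| + 1 + |A - b| / c, fun t ht => ?_⟩
  have h1 : 0 ≤ |B| / c := by positivity
  have h2 : 0 ≤ |A - b| / c := by positivity
  have ht1 : 1 ≤ t := by linarith [abs_nonneg (A - b)]
  have h3 : |B| + |A - b| ≤ c * t := by
    have : |B| / c + |A - b| / c ≤ t := by linarith [abs_nonneg (A - b)]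
    rw [← add_div, div_le_iff₀ hc] at this
    linarith
  have h4 : (|B| + |A - b|) * t ≤ c * t * t := mul_le_mul_of_nonneg_right h3 (by linarith)
  have h5 : B * t ≤ |B| * t := mul_le_mul_of_nonneg_right (le_abs_self B) (by linarith)
  have h6 : |A - b| * 1 ≤ |A - b| * t := mul_le_mul_of_nonneg_left ht1 (abs_nonneg _)
  nlinarith [le_abs_self (A - b)]

end Corrector

/-! ### The gradient constraint in integrated form. -/

namespace Corrector

variable {d : ℕ} {lam : Matrix (Fin (d + 1)) (Fin (d + 1)) ℝ}

theorem _root_.UpperSemicontinuous.sub_continuous {X : Type*} [TopologicalSpace X] {u φ : X → ℝ}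
    (hu : UpperSemicontinuous u) (hφ : Continuous φ) :
    UpperSemicontinuous fun y => u y - φ y := by
  simp only [sub_eq_add_neg]
  exact hu.add hφ.neg.upperSemicontinuous

/-- Near `x₀` semicontinuity suffices; outside a ball of radius `r` a large multiple of `‖z‖²`
dominates the linear growth. -/
theorem exists_penalty_le {u : E d → ℝ} (hu : UpperSemicontinuous u) {A B : ℝ}
    (hB : 0 ≤ B) (x₀ : E d) (hgrow : ∀ z, u (x₀ + z) ≤ A + B * ‖z‖) {ε : ℝ} (hε : 0 < ε) :
    ∃ N : ℝ, 0 < N ∧ ∀ z, u (x₀ + z) - N * ‖z‖ ^ 2 ≤ u x₀ + ε := by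
  obtain ⟨r, hr, hr'⟩ := Metric.eventually_nhds_iff.1 (hu x₀ (u x₀ + ε) (by linarith))
  have hN : 0 ≤ |A - u x₀| / r ^ 2 + B / r := by positivity
  refine ⟨|A - u x₀| / r ^ 2 + B / r + 1, by linarith, fun z => ?_⟩
  rcases lt_or_ge ‖z‖ r with hz | hz
  · have := hr' (y := x₀ + z) (by simpa [dist_eq_norm] using hz)
    have h2 : 0 ≤ (|A - u x₀| / r ^ 2 + B / r + 1) * ‖z‖ ^ 2 := by positivity
    linarith
  · have h1 : |A - u x₀| ≤ |A - u x₀| / r ^ 2 * ‖z‖ ^ 2 := by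
      rw [div_mul_eq_mul_div, le_div_iff₀ (by positivity)]
      exact mul_le_mul_of_nonneg_left (pow_le_pow_left₀ hr.le hz 2) (abs_nonneg _)
    have h2 : B * ‖z‖ ≤ B / r * ‖z‖ ^ 2 := by
      rw [div_mul_eq_mul_div, le_div_iff₀ hr, mul_assoc, sq]
      exact mul_le_mul_of_nonneg_left (mul_le_mul_of_nonneg_left hz (norm_nonneg _)) hB
    have h3 := hgrow z
    nlinarith [le_abs_self (A - u x₀), sq_nonneg ‖z‖]

/-- A subsolution of `⟪e, Du⟫ ≤ c` grows at most by `c` along the vector `e`. -/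
theorem le_add_of_viscosity_inner_le {u : E d → ℝ} (hu : UpperSemicontinuous u) {A B : ℝ}
    (hB : 0 ≤ B) (hgrow : ∀ x, u x ≤ A + B * ‖x‖) {e : E d} (he : e ≠ 0) {c : ℝ} (hc : 0 ≤ c)
    (hv : ∀ (φ : E d → ℝ) (x : E d), ContDiff ℝ 2 φ → IsLocalMax (fun y => u y - φ y) x →
      inner ℝ (gradient φ x) e ≤ c) (x₀ : E d) : u (x₀ + e) ≤ u x₀ + c := by
  refine le_of_forall_pos_le_add fun ε hε => ?_
  have hgrow' : ∀ z, u (x₀ + z) ≤ (A + B * ‖x₀‖) + B * ‖z‖ := fun z =>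
    (hgrow _).trans (by nlinarith [norm_add_le x₀ z])
  obtain ⟨N, hN, hNle⟩ := exists_penalty_le hu hB x₀ hgrow' (ε := ε / 3) (by positivity)
  have hn : 0 < ‖e‖ ^ 2 := by positivity
  -- `t` is the coordinate along `e`, equal to `0` at `x₀` and `1` at `x₀ + e`. The bracket
  -- multiplied by `N` in `φ` is the squared distance to the line through `x₀`, constant along `e`,
  -- so the slope of `φ` along `e` exceeds `c` wherever `t ≥ 0`. The term in `t²` makes `φ` coercive
  -- on this half-space.
  set t : E d → ℝ := fun y => inner ℝ e (y - x₀) / ‖e‖ ^ 2 with ht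
  set φ : E d → ℝ := fun y => (c + ε / 3) * t y + ε / 3 * t y ^ 2 +
    N * (‖y - x₀‖ ^ 2 - ‖e‖ ^ 2 * t y ^ 2) with hφ
  have htC : ContDiff ℝ 2 t := by
    rw [ht]
    exact (contDiff_const.inner ℝ (contDiff_id.sub contDiff_const)).div_const _
  have hφC : ContDiff ℝ 2 φ := by
    have : ContDiff ℝ 2 fun y : E d => ‖y - x₀‖ ^ 2 :=
      (contDiff_id.sub contDiff_const).norm_sq ℝ
    rw [hφ]
    fun_prop
  have htline : ∀ y s, t (y + s • e) = t y + s := by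
    intro y s
    simp only [ht, add_sub_right_comm, inner_add_right, real_inner_smul_right,
      real_inner_self_eq_norm_sq, add_div]
    rw [mul_div_cancel_right₀ _ hn.ne']
  have hin : ∀ y, inner ℝ e (y - x₀) = ‖e‖ ^ 2 * t y := fun y => by
    simp only [ht]; field_simp
  have hline : ∀ y s, φ (y + s • e) = φ y + (s * (c + ε / 3 + 2 * (ε / 3) * t y) + ε / 3 * s ^ 2) := by
    intro y s
    have h1 : ‖y + s • e - x₀‖ ^ 2 = ‖y - x₀‖ ^ 2 + 2 * (s * (‖e‖ ^ 2 * t y)) + s ^ 2 * ‖e‖ ^ 2 := by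
      rw [add_sub_right_comm, norm_add_sq_real, real_inner_smul_right, real_inner_comm, hin,
        norm_smul, mul_pow, Real.norm_eq_abs, sq_abs]
    simp only [hφ, htline, h1]
    ring
  have hgrad : ∀ y, inner ℝ (gradient φ y) e = c + ε / 3 + 2 * (ε / 3) * t y := by
    intro y
    have hd : DifferentiableAt ℝ φ y := (hφC.differentiable (by norm_num)).differentiableAt
    rw [gradient, InnerProductSpace.toDual_symm_apply, ← hd.lineDeriv_eq_fderiv]
    apply HasLineDerivAt.lineDeriv
    unfold HasLineDerivAt
    simp only [hline]
    have h1 : HasDerivAt (fun s : ℝ => s * (c + ε / 3 + 2 * (ε / 3) * t y))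
        (1 * (c + ε / 3 + 2 * (ε / 3) * t y)) 0 := (hasDerivAt_id 0).mul_const _
    have h2 : HasDerivAt (fun s : ℝ => ε / 3 * s ^ 2) (ε / 3 * (2 * 0)) 0 := by
      simpa using ((hasDerivAt_id (0 : ℝ)).pow 2).const_mul (ε / 3)
    simpa using (h1.add h2).const_add (φ y)
  set H : Set (E d) := {y | 0 ≤ t y} with hH
  have hHc : IsClosed H := isClosed_le continuous_const htC.continuous
  have hx₀H : x₀ ∈ H := by simp [hH, ht]
  have husc : UpperSemicontinuous fun y => u y - φ y := hu.sub_continuous hφC.continuous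
  have hcs : ∀ y, ‖e‖ ^ 2 * t y ^ 2 ≤ ‖y - x₀‖ ^ 2 := by
    intro y
    have h1 := abs_real_inner_le_norm e (y - x₀)
    rw [hin] at h1
    have h2 := pow_le_pow_left₀ (abs_nonneg _) h1 2
    rw [sq_abs, mul_pow, mul_pow] at h2
    exact le_of_mul_le_mul_left (by linarith) hn
  set k : ℝ := min N (ε / 3 / ‖e‖ ^ 2) with hk
  have hk0 : 0 < k := lt_min hN (by positivity)
  have hφlow : ∀ y ∈ H, k * ‖y - x₀‖ ^ 2 ≤ φ y := by
    intro y hy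
    have h0 : 0 ≤ t y := hy
    have h1 : k * (‖e‖ ^ 2 * t y ^ 2) ≤ ε / 3 * t y ^ 2 := by
      have : k * ‖e‖ ^ 2 ≤ ε / 3 := by
        rw [← le_div_iff₀ hn]; exact min_le_right _ _
      nlinarith [mul_le_mul_of_nonneg_right this (sq_nonneg (t y))]
    have h2 : k * (‖y - x₀‖ ^ 2 - ‖e‖ ^ 2 * t y ^ 2) ≤ N * (‖y - x₀‖ ^ 2 - ‖e‖ ^ 2 * t y ^ 2) :=
      mul_le_mul_of_nonneg_right (min_le_left _ _) (sub_nonneg.2 (hcs y))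
    have h3 : 0 ≤ (c + ε / 3) * t y := by positivity
    simp only [hφ]
    linarith
  obtain ⟨R, hR⟩ := exists_forall_add_mul_sub_sq_le (A + B * ‖x₀‖) B (u x₀ - φ x₀) hk0
  obtain ⟨y, hyH, hymax⟩ := exists_isMaxOn_of_coercive husc hHc hx₀H (R := R + ‖x₀‖) (by
    intro y hy hRy
    have h1 : R ≤ ‖y - x₀‖ := by linarith [norm_sub_norm_le y x₀]
    have h2 := hR _ h1
    have h3 := hgrow' (y - x₀)
    rw [add_sub_cancel] at h3
    linarith [hφlow y hy])
  -- An interior maximum would be a local one, contradicting the slope bound; so the maximum lies on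
  -- the hyperplane `t = 0`, where `φ` is just the penalty.
  have hy0 : t y = 0 := by
    refine le_antisymm (not_lt.1 fun hpos => ?_) hyH
    have hloc : IsLocalMax (fun y => u y - φ y) y :=
      hymax.isLocalMax (mem_of_superset ((isOpen_lt continuous_const htC.continuous).mem_nhds hpos)
        fun z (hz : 0 < t z) => hz.le)
    have := hv φ y hφC hloc
    rw [hgrad] at this
    have : 0 ≤ 2 * (ε / 3) * t y := by positivity
    linarith
  have htx : t x₀ = 0 := by simp [ht]
  have hφx : φ x₀ = 0 := by simp [hφ, htx]
  have hte : t (x₀ + e) = 1 := by simpa [htx] using htline x₀ 1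
  have hφe : φ (x₀ + e) = c + 2 * (ε / 3) := by
    have := hline x₀ 1
    rw [hφx, htx, one_smul] at this
    rw [this]; ring
  have heH : x₀ + e ∈ H := by simp [hH, hte]
  have h1 := hymax heH
  simp only [Set.mem_ofPred_eq] at h1
  have h2 : φ y = N * ‖y - x₀‖ ^ 2 := by simp [hφ, hy0]
  have h3 := hNle (y - x₀)
  rw [add_sub_cancel] at h3
  rw [hφe, h2] at h1
  linarith

/-- The gradient constraint in integrated form. -/
theorem le_add_deltaC_of_viscosity (hlam : ∀ i j, 0 ≤ lam i j) {u : E d → ℝ}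
    (hu : UpperSemicontinuous u) {A B : ℝ} (hB : 0 ≤ B) (hgrow : ∀ x, u x ≤ A + B * ‖x‖)
    (hv : ∀ (φ : E d → ℝ) (x : E d), ContDiff ℝ 2 φ → IsLocalMax (fun y => u y - φ y) x →
      gradient φ x ∈ polyC lam) (x e : E d) : u (x + e) ≤ u x + deltaC lam e := by
  rcases eq_or_ne e 0 with rfl | he
  · simpa using deltaC_nonneg hlam 0
  · exact le_add_of_viscosity_inner_le hu hB hgrow he (deltaC_nonneg hlam e)
      (fun φ x hφ hx => inner_le_deltaC (hv φ x hφ hx) e) x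

end Corrector

/-! ### Mollification. -/

namespace Corrector

variable {d : ℕ} {lam : Matrix (Fin (d + 1)) (Fin (d + 1)) ℝ}

/-- `C²` functions whose second derivative is `K`-Lipschitz. -/
structure HasLipschitzHessian (K : ℝ) (g : E d → ℝ) : Prop where
  contDiff : ContDiff ℝ 2 g
  lipschitz : ∀ x y, ‖fderiv ℝ (fderiv ℝ g) x - fderiv ℝ (fderiv ℝ g) y‖ ≤ K * ‖x - y‖

section Mollify

open MeasureTheory

variable {F : Type*} [NormedAddCommGroup F] [NormedSpace ℝ F]

/-- The convolution `x ↦ ∫ u(x - t) ψ(t) dt`. -/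
noncomputable def mollify (ψ : E d → F) (u : E d → ℝ) : E d → F :=
  convolution ψ u (ContinuousLinearMap.lsmul ℝ ℝ).flip volume

theorem mollify_apply (ψ : E d → F) (u : E d → ℝ) (x : E d) :
    mollify ψ u x = ∫ t, u (x - t) • ψ t := rfl

theorem integrable_mollify {ψ : E d → F} (hψ : Continuous ψ) (hψc : HasCompactSupport ψ)
    {u : E d → ℝ} (hu : Continuous u) (x : E d) : Integrable (fun t => u (x - t) • ψ t) :=
  hψc.convolutionExists_left (ContinuousLinearMap.lsmul ℝ ℝ).flip (μ := volume) hψ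
    hu.locallyIntegrable x

theorem fderiv_mollify {ψ : E d → F} (hψ : ContDiff ℝ 1 ψ) (hψc : HasCompactSupport ψ)
    {u : E d → ℝ} (hu : Continuous u) : fderiv ℝ (mollify ψ u) = mollify (fderiv ℝ ψ) u := by
  funext x
  have h := hψc.hasFDerivAt_convolution_left (ContinuousLinearMap.lsmul ℝ ℝ).flip
    (μ := volume) hψ hu.locallyIntegrable x
  exact h.fderiv

theorem norm_mollify_sub_le {ψ : E d → F} (hψ : Continuous ψ) (hψc : HasCompactSupport ψ)
    {u : E d → ℝ} {M : ℝ} (hc : Continuous u) (hu : ∀ x y, |u x - u y| ≤ M * ‖x - y‖)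
    (x y : E d) :
    ‖mollify ψ u x - mollify ψ u y‖ ≤ (M * ∫ t, ‖ψ t‖) * ‖x - y‖ := by
  rw [mollify_apply, mollify_apply,
    ← integral_sub (integrable_mollify hψ hψc hc x) (integrable_mollify hψ hψc hc y)]
  have hψint : Integrable (fun t => ‖ψ t‖) (volume : Measure (E d)) :=
    (hψ.integrable_of_hasCompactSupport hψc).norm
  calc _ ≤ ∫ t, (M * ‖x - y‖) * ‖ψ t‖ := by
        refine norm_integral_le_of_norm_le (hψint.const_mul _) (Eventually.of_forall fun t => ?_)
        rw [← sub_smul, norm_smul, Real.norm_eq_abs]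
        have h1 := hu (x - t) (y - t)
        rw [sub_sub_sub_cancel_right] at h1
        exact mul_le_mul_of_nonneg_right h1 (norm_nonneg _)
    _ = _ := by rw [integral_const_mul]; ring

/-- Smooth approximation from above that preserves the growth constraint. -/
theorem exists_smooth_approx (hlam : ∀ i j, 0 ≤ lam i j) {u : E d → ℝ}
    (hu : ∀ x e, u (x + e) ≤ u x + deltaC lam e) {ε : ℝ} (hε : 0 < ε) :
    ∃ (K : ℝ) (g : E d → ℝ), 0 ≤ K ∧ HasLipschitzHessian K g ∧
      (∀ x e, g (x + e) ≤ g x + deltaC lam e) ∧ ∀ x, u x ≤ g x ∧ g x ≤ u x + ε := by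
  obtain ⟨M, hM0, hM⟩ := exists_deltaC_le_mul_norm hlam
  have hle : ∀ x y, u x - u y ≤ M * ‖x - y‖ := by
    intro x y
    have h1 := hu y (x - y)
    rw [add_sub_cancel] at h1
    linarith [hM (x - y)]
  have hlip : ∀ x y, |u x - u y| ≤ M * ‖x - y‖ := fun x y =>
    abs_le.2 ⟨by rw [norm_sub_rev]; linarith [hle y x], hle x y⟩
  have hc : Continuous u :=
    (LipschitzWith.of_le_add_mul ⟨M, hM0⟩ fun x y => by
      rw [dist_eq_norm]; change _ ≤ _ + M * _; linarith [hle x y]).continuous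
  have hr : 0 < ε / 2 / (M + 1) := by positivity
  -- With Lipschitz constant `M`, this radius makes the mollification error at most `ε / 2`; adding
  -- `ε / 2` then puts the approximation above `u`.
  let φ : ContDiffBump (0 : E d) := ⟨ε / 2 / (M + 1) / 2, ε / 2 / (M + 1), by positivity, by linarith⟩
  set η : E d → ℝ := φ.normed volume with hη
  have hηc : HasCompactSupport η := φ.hasCompactSupport_normed
  have hηd : ContDiff ℝ 2 η := φ.contDiff_normed
  have hη1 : ContDiff ℝ 1 η := φ.contDiff_normed
  have hηd1 : ContDiff ℝ 1 (fderiv ℝ η) := hηd.fderiv_right (by norm_num)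
  have hul := hc.locallyIntegrable (μ := (volume : Measure (E d)))
  set G : E d → ℝ := mollify η u with hG
  have hGd : ContDiff ℝ 2 G := hηc.contDiff_convolution_left (n := 2) _ hηd hul
  have hf2 : fderiv ℝ (fderiv ℝ G) = mollify (fderiv ℝ (fderiv ℝ η)) u := by
    rw [hG, fderiv_mollify hη1 hηc hc, fderiv_mollify hηd1 (hηc.fderiv ℝ) hc]
  have hfd : ∀ x, fderiv ℝ (fun y => G y + ε / 2) x = fderiv ℝ G x := fun x => by
    rw [fderiv_add_const]
  refine ⟨M * ∫ t, ‖fderiv ℝ (fderiv ℝ η) t‖,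
    fun x => G x + ε / 2, ?_, ⟨hGd.add contDiff_const, ?_⟩, ?_, ?_⟩
  · exact mul_nonneg hM0 (integral_nonneg fun t => norm_nonneg (fderiv ℝ (fderiv ℝ η) t))
  · intro x y
    rw [funext hfd, hf2]
    exact norm_mollify_sub_le (hηd1.continuous_fderiv (by norm_num))
      ((hηc.fderiv ℝ).fderiv ℝ) hc hlip x y
  · intro x e
    have hex := integrable_mollify hηd.continuous hηc hc
    have hψint : Integrable η volume := hηd.continuous.integrable_of_hasCompactSupport hηc
    have h1 : G (x + e) ≤ ∫ t, (u (x - t) • η t + η t * deltaC lam e) := by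
      refine integral_mono (hex (x + e)) ((hex x).add (hψint.mul_const _)) fun t => ?_
      have h2 := hu (x - t) e
      have h3 : x - t + e = x + e - t := by abel
      rw [h3] at h2
      have h4 : 0 ≤ η t := φ.nonneg_normed t
      change u (x + e - t) * η t ≤ u (x - t) * η t + η t * deltaC lam e
      nlinarith
    rw [integral_add (hex x) (hψint.mul_const _), integral_mul_const, φ.integral_normed] at h1
    change G (x + e) ≤ G x + _ at h1
    change G (x + e) + ε / 2 ≤ G x + ε / 2 + _
    linarith
  · intro x
    have h1 : dist (G x) (u x) ≤ ε / 2 := by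
      have hGx : G x = convolution (φ.normed volume) u (ContinuousLinearMap.lsmul ℝ ℝ) volume x :=
        integral_congr_ae (Eventually.of_forall fun t => mul_comm _ _)
      rw [hGx]
      refine φ.dist_normed_convolution_le hc.aestronglyMeasurable fun y hy => ?_
      rw [Metric.mem_ball, dist_eq_norm] at hy
      rw [Real.dist_eq]
      have hy' : ‖y - x‖ ≤ ε / 2 / (M + 1) := hy.le
      rw [le_div_iff₀ (by positivity)] at hy'
      nlinarith [hlip y x, norm_nonneg (y - x)]
    rw [Real.dist_eq] at h1
    obtain ⟨h2, h3⟩ := abs_le.1 h1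
    exact ⟨by linarith, by linarith⟩

end Mollify

end Corrector

/-! ### Second derivatives of averages and second differences. -/

namespace Corrector

variable {d : ℕ}

section SecondDerivative

variable {ι : Type*}

theorem fderiv_fderiv_comp_add (g : E d → ℝ) (v x : E d) :
    fderiv ℝ (fderiv ℝ fun y => g (y + v)) x = fderiv ℝ (fderiv ℝ g) (x + v) := by
  have h : (fderiv ℝ fun y => g (y + v)) = fun y => fderiv ℝ g (y + v) :=
    funext fun y => fderiv_comp_add_right v
  rw [h, fderiv_comp_add_right]

theorem _root_.ContDiff.differentiableAt_fderiv_two {g : E d → ℝ} (hg : ContDiff ℝ 2 g) (x : E d) :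
    DifferentiableAt ℝ (fderiv ℝ g) x :=
  ((hg.fderiv_right (m := 1) (by norm_num)).differentiable (by norm_num)).differentiableAt

theorem fderiv_fderiv_sum (s : Finset ι) (c : ι → ℝ) {g : ι → E d → ℝ}
    (hg : ∀ i ∈ s, ContDiff ℝ 2 (g i)) (x : E d) :
    fderiv ℝ (fderiv ℝ fun y => ∑ i ∈ s, c i * g i y) x =
      ∑ i ∈ s, c i • fderiv ℝ (fderiv ℝ (g i)) x := by
  have h : (fderiv ℝ fun y => ∑ i ∈ s, c i * g i y) = fun y => ∑ i ∈ s, c i • fderiv ℝ (g i) y := by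
    funext y
    have hd : ∀ i ∈ s, DifferentiableAt ℝ (g i) y := fun i hi =>
      ((hg i hi).differentiable (by norm_num)).differentiableAt
    rw [fderiv_fun_sum fun i hi => (hd i hi).const_mul (c i)]
    exact Finset.sum_congr rfl fun i hi => fderiv_const_mul (hd i hi) _
  rw [h, fderiv_fun_sum fun i hi => ((hg i hi).differentiableAt_fderiv_two x).fun_const_smul (c i)]
  exact Finset.sum_congr rfl fun i hi =>
    fderiv_fun_const_smul ((hg i hi).differentiableAt_fderiv_two x) _

theorem HasLipschitzHessian.comp_add {K : ℝ} {g : E d → ℝ} (hg : HasLipschitzHessian K g)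
    (v : E d) : HasLipschitzHessian K fun x => g (x + v) where
  contDiff := hg.contDiff.comp (contDiff_id.add contDiff_const)
  lipschitz x y := by
    rw [fderiv_fderiv_comp_add, fderiv_fderiv_comp_add]
    simpa using hg.lipschitz (x + v) (y + v)

theorem norm_weighted_sum_sub_le {F : Type*} [NormedAddCommGroup F] [NormedSpace ℝ F]
    {s : Finset ι} {c : ι → ℝ} {a b : ι → F} {C : ℝ} (hc : ∀ i ∈ s, 0 ≤ c i)
    (hc1 : ∑ i ∈ s, c i = 1) (h : ∀ i ∈ s, ‖a i - b i‖ ≤ C) :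
    ‖∑ i ∈ s, c i • a i - ∑ i ∈ s, c i • b i‖ ≤ C := by
  rw [← Finset.sum_sub_distrib]
  calc _ ≤ ∑ i ∈ s, c i * C := by
        refine norm_sum_le_of_le _ fun i hi => ?_
        rw [← smul_sub, norm_smul, Real.norm_of_nonneg (hc i hi)]
        exact mul_le_mul_of_nonneg_left (h i hi) (hc i hi)
    _ = C := by rw [← Finset.sum_mul, hc1, one_mul]

/-- Convex weights keep the same constant `K`, so iterating the walk loses no regularity. -/
theorem HasLipschitzHessian.sum {K : ℝ} {s : Finset ι} {c : ι → ℝ} {g : ι → E d → ℝ}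
    (hc : ∀ i ∈ s, 0 ≤ c i) (hc1 : ∑ i ∈ s, c i = 1) (hg : ∀ i ∈ s, HasLipschitzHessian K (g i)) :
    HasLipschitzHessian K fun x => ∑ i ∈ s, c i * g i x where
  contDiff := ContDiff.sum fun i hi => contDiff_const.mul (hg i hi).contDiff
  lipschitz x y := by
    rw [fderiv_fderiv_sum s c fun i hi => (hg i hi).contDiff,
      fderiv_fderiv_sum s c fun i hi => (hg i hi).contDiff]
    exact norm_weighted_sum_sub_le (F := E d →L[ℝ] E d →L[ℝ] ℝ)
      (a := fun i => fderiv ℝ (fderiv ℝ (g i)) x) (b := fun i => fderiv ℝ (fderiv ℝ (g i)) y)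
      hc hc1 fun i hi => (hg i hi).lipschitz x y

theorem hasDerivAt_comp_line {F : Type*} [NormedAddCommGroup F] [NormedSpace ℝ F] {g : E d → F}
    (hg : Differentiable ℝ g) (x w : E d) (s : ℝ) :
    HasDerivAt (fun s : ℝ => g (x + s • w)) (fderiv ℝ g (x + s • w) w) s := by
  have h1 : HasDerivAt (fun s : ℝ => x + s • w) w s := by
    simpa using ((hasDerivAt_id s).smul_const w).const_add x
  exact (hg (x + s • w)).hasFDerivAt.comp_hasDerivAt s h1

/-- Let `Q = D²g(x)(v, v)`. The function `g(x + sv) + g(x - sv) - s²Q` has zero derivative at `s =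
0`, and its second derivative is at most `2K‖v‖³` on `[0, 1)`; the mean value inequality is applied
twice. -/
theorem HasLipschitzHessian.abs_second_difference_le {K : ℝ} {g : E d → ℝ} (hK : 0 ≤ K)
    (hg : HasLipschitzHessian K g) (x v : E d) :
    |g (x + v) + g (x + -v) - 2 * g x - fderiv ℝ (fderiv ℝ g) x v v| ≤ 2 * K * ‖v‖ ^ 3 := by
  have hd : Differentiable ℝ g := hg.contDiff.differentiable (by norm_num)
  have hd' : Differentiable ℝ (fderiv ℝ g) := fun y => hg.contDiff.differentiableAt_fderiv_two y
  set Q : ℝ := fderiv ℝ (fderiv ℝ g) x v v with hQ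
  have hp : ∀ s : ℝ, HasDerivAt
      (fun s : ℝ => fderiv ℝ g (x + s • v) v - fderiv ℝ g (x + s • -v) v - s * (2 * Q))
      (fderiv ℝ (fderiv ℝ g) (x + s • v) v v + fderiv ℝ (fderiv ℝ g) (x + s • -v) v v - 2 * Q) s := by
    intro s
    have h1 := (hasDerivAt_comp_line hd' x v s).clm_apply (hasDerivAt_const s v)
    have h2 := (hasDerivAt_comp_line hd' x (-v) s).clm_apply (hasDerivAt_const s v)
    refine ((h1.sub h2).sub ((hasDerivAt_id s).mul_const (2 * Q))).congr_deriv ?_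
    simp
  have hlip : ∀ w : E d, ‖w‖ = ‖v‖ → ∀ s ∈ Set.Ico (0 : ℝ) 1,
      |fderiv ℝ (fderiv ℝ g) (x + s • w) v v - Q| ≤ K * ‖v‖ ^ 3 := by
    intro w hw s hs
    have h1 := hg.lipschitz (x + s • w) x
    rw [add_sub_cancel_left, norm_smul, Real.norm_of_nonneg hs.1, hw] at h1
    have h2 := ContinuousLinearMap.le_opNorm₂
      (fderiv ℝ (fderiv ℝ g) (x + s • w) - fderiv ℝ (fderiv ℝ g) x) v v
    have h3 : K * (s * ‖v‖) ≤ K * ‖v‖ :=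
      mul_le_mul_of_nonneg_left (mul_le_of_le_one_left (norm_nonneg _) hs.2.le) hK
    calc _ = ‖(fderiv ℝ (fderiv ℝ g) (x + s • w) - fderiv ℝ (fderiv ℝ g) x) v v‖ := by
          simp [hQ]
      _ ≤ _ := h2
      _ ≤ K * ‖v‖ * ‖v‖ * ‖v‖ := by gcongr; exact h1.trans h3
      _ = _ := by ring
  have hpb : ∀ s ∈ Set.Icc (0 : ℝ) 1,
      ‖fderiv ℝ g (x + s • v) v - fderiv ℝ g (x + s • -v) v - s * (2 * Q)‖ ≤ 2 * K * ‖v‖ ^ 3 := by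
    intro s hs
    have h := norm_image_sub_le_of_norm_deriv_le_segment' (C := 2 * K * ‖v‖ ^ 3)
      (fun t _ => (hp t).hasDerivWithinAt) (fun t ht => by
        have h1 := hlip v rfl t ht
        have h2 := hlip (-v) (norm_neg v) t ht
        rw [Real.norm_eq_abs]
        rw [abs_le] at h1 h2 ⊢
        exact ⟨by linarith, by linarith⟩) s hs
    simp only [zero_smul, add_zero, sub_self, zero_mul, sub_zero] at h
    exact h.trans (mul_le_of_le_one_right (by positivity) hs.2)
  have hq : ∀ s : ℝ, HasDerivAt
      (fun s : ℝ => g (x + s • v) + g (x + s • -v) - s ^ 2 * Q)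
      (fderiv ℝ g (x + s • v) v - fderiv ℝ g (x + s • -v) v - s * (2 * Q)) s := by
    intro s
    refine (((hasDerivAt_comp_line hd x v s).add (hasDerivAt_comp_line hd x (-v) s)).sub
      (((hasDerivAt_id s).pow 2).mul_const Q)).congr_deriv ?_
    simp
    ring
  have h := norm_image_sub_le_of_norm_deriv_le_segment' (C := 2 * K * ‖v‖ ^ 3)
      (fun t _ => (hq t).hasDerivWithinAt) (fun t ht => hpb t ⟨ht.1, ht.2.le⟩) 1
      (Set.right_mem_Icc.2 zero_le_one)
  rw [Real.norm_eq_abs] at h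
  simp only [one_smul, zero_smul, add_zero, sub_zero, mul_one, one_pow, one_mul] at h
  refine le_trans (le_of_eq ?_) h
  congr 1
  ring

end SecondDerivative

/-! ### The constant-coefficient second order operator. -/

section Generator

/-- The `k`-th column of a matrix. -/
noncomputable def column (α : Matrix (Fin d) (Fin d) ℝ) (k : Fin d) : E d :=
  WithLp.toLp 2 fun i => α i k

/-- The second order operator `φ ↦ Tr(α αᵀ D²φ) / 2`. -/
noncomputable def generator (α : Matrix (Fin d) (Fin d) ℝ) (φ : E d → ℝ) (x : E d) : ℝ :=
  (α * α.transpose * hessian φ x).trace / 2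

theorem column_eq_sum (α : Matrix (Fin d) (Fin d) ℝ) (k : Fin d) :
    column α k = ∑ i, α i k • EuclideanSpace.single i (1 : ℝ) := by
  ext j
  simp [column, Finset.sum_apply, Pi.single_apply]

theorem generator_eq (α : Matrix (Fin d) (Fin d) ℝ) (φ : E d → ℝ) (x : E d) :
    generator α φ x = (∑ k, fderiv ℝ (fderiv ℝ φ) x (column α k) (column α k)) / 2 := by
  unfold generator
  congr 1
  simp only [column_eq_sum, map_sum, map_smul, _root_.sum_apply,
    _root_.smul_apply, Matrix.trace, Matrix.diag, Matrix.mul_apply,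
    Matrix.transpose_apply, hessian, Matrix.of_apply, Finset.sum_mul, smul_eq_mul]
  rw [Finset.sum_congr rfl fun i _ => Finset.sum_comm, Finset.sum_comm]
  refine Finset.sum_congr rfl fun k _ => Finset.sum_congr rfl fun i _ => ?_
  rw [Finset.mul_sum]
  exact Finset.sum_congr rfl fun j _ => by ring

variable {α : Matrix (Fin d) (Fin d) ℝ}

theorem generator_sum {ι : Type*} (s : Finset ι) (c : ι → ℝ) {g : ι → E d → ℝ}
    (hg : ∀ i ∈ s, ContDiff ℝ 2 (g i)) (x : E d) :
    generator α (fun y => ∑ i ∈ s, c i * g i y) x = ∑ i ∈ s, c i * generator α (g i) x := by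
  simp only [generator_eq, fderiv_fderiv_sum s c hg, _root_.sum_apply,
    _root_.smul_apply, smul_eq_mul]
  rw [Finset.sum_comm, Finset.sum_div]
  refine Finset.sum_congr rfl fun i _ => ?_
  rw [← Finset.mul_sum, mul_div_assoc]

theorem generator_add {f g : E d → ℝ} (hf : ContDiff ℝ 2 f) (hg : ContDiff ℝ 2 g) (x : E d) :
    generator α (fun y => f y + g y) x = generator α f x + generator α g x := by
  have h := generator_sum (α := α) (Finset.univ : Finset (Fin 2)) (fun _ => 1) (g := ![f, g])
    (by simp [Fin.forall_fin_two, hf, hg]) x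
  simpa using h

theorem generator_const_mul (c : ℝ) {f : E d → ℝ} (hf : ContDiff ℝ 2 f) (x : E d) :
    generator α (fun y => c * f y) x = c * generator α f x := by
  have h := generator_sum (α := α) (Finset.univ : Finset (Fin 1)) (fun _ => c) (g := ![f])
    (by simp [hf]) x
  simpa using h

theorem generator_add_const (f : E d → ℝ) (c : ℝ) (x : E d) :
    generator α (fun y => f y + c) x = generator α f x := by
  have h : (fderiv ℝ fun y => f y + c) = fderiv ℝ f := funext fun y => fderiv_add_const c
  simp only [generator_eq, h]

theorem generator_comp_add (g : E d → ℝ) (v x : E d) :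
    generator α (fun y => g (y + v)) x = generator α g (x + v) := by
  simp only [generator_eq, fderiv_fderiv_comp_add]

/-- The generator of a quadratic form is a nonnegative constant. -/
theorem exists_generator_norm_sq_eq (α : Matrix (Fin d) (Fin d) ℝ) (B : E d →ₗ[ℝ] E d) :
    ∃ c : ℝ, 0 ≤ c ∧ ∀ x, generator α (fun y => ‖B y‖ ^ 2) x = c := by
  set T : E d →L[ℝ] E d := B.toContinuousLinearMap with hT
  have hTB : ∀ y, T y = B y := fun y => rfl
  have h1 : (fderiv ℝ fun y : E d => ‖B y‖ ^ 2) =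
      fun y => (2 : ℝ) • ((innerSL ℝ).bilinearComp T T) y := by
    funext y
    have := (T.hasFDerivAt (x := y)).norm_sq
    refine (this.congr_of_eventuallyEq (Eventually.of_forall fun z => rfl)).fderiv.trans ?_
    ext v
    simp
  have h2 : ∀ x, fderiv ℝ (fderiv ℝ fun y : E d => ‖B y‖ ^ 2) x =
      (2 : ℝ) • ((innerSL ℝ).bilinearComp T T) := by
    intro x
    rw [h1]
    exact ((2 : ℝ) • ((innerSL ℝ).bilinearComp T T)).fderiv
  refine ⟨(∑ k, 2 * ‖T (column α k)‖ ^ 2) / 2, by positivity, fun x => ?_⟩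
  rw [generator_eq, h2]
  simp

end Generator

/-! ### The random walk and its consistency with the generator. -/

section RandomWalk

/-- The increments `± r α_k` of the random walk along the columns of `α`. -/
noncomputable def walkStep (α : Matrix (Fin d) (Fin d) ℝ) (r : ℝ) (q : Fin d × Bool) : E d :=
  if q.2 then r • column α q.1 else -(r • column α q.1)

/-- The transition operator of the random walk along the columns of `α`. -/
noncomputable def walkOp (α : Matrix (Fin d) (Fin d) ℝ) (r : ℝ) (g : E d → ℝ) (x : E d) : ℝ :=
  ∑ q : Fin d × Bool, (1 / (2 * d) : ℝ) * g (x + walkStep α r q)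

theorem sum_walk_weights (hd : d ≠ 0) : ∑ _q : Fin d × Bool, (1 / (2 * d) : ℝ) = 1 := by
  have : (d : ℝ) ≠ 0 := Nat.cast_ne_zero.2 hd
  simp
  field_simp

theorem HasLipschitzHessian.walkOp (hd : d ≠ 0) {α : Matrix (Fin d) (Fin d) ℝ} {r K : ℝ}
    {g : E d → ℝ} (hg : HasLipschitzHessian K g) : HasLipschitzHessian K (walkOp α r g) :=
  HasLipschitzHessian.sum (fun _ _ => by positivity) (sum_walk_weights hd)
    fun q _ => hg.comp_add (walkStep α r q)

/-- The coefficients are constant, so the generator commutes with translations. -/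
theorem generator_walkOp {α : Matrix (Fin d) (Fin d) ℝ} {r : ℝ} {g : E d → ℝ}
    (hg : ContDiff ℝ 2 g) (x : E d) :
    generator α (walkOp α r g) x = walkOp α r (generator α g) x := by
  unfold walkOp
  rw [generator_sum (g := fun q y => g (y + walkStep α r q)) _ _
    fun q _ => hg.comp (contDiff_id.add contDiff_const)]
  exact Finset.sum_congr rfl fun q _ => by rw [generator_comp_add]

theorem walkOp_sub_self (hd : d ≠ 0) (α : Matrix (Fin d) (Fin d) ℝ) (r : ℝ) (g : E d → ℝ)
    (x : E d) : walkOp α r g x - g x =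
      ∑ q : Fin d × Bool, (1 / (2 * d) : ℝ) * (g (x + walkStep α r q) - g x) := by
  simp only [mul_sub, Finset.sum_sub_distrib, walkOp]
  rw [← Finset.sum_mul, sum_walk_weights hd, one_mul]

theorem abs_walkOp_sub_le (hd : d ≠ 0) {α : Matrix (Fin d) (Fin d) ℝ} {r C : ℝ} {g : E d → ℝ}
    {x : E d} (h : ∀ q, |g (x + walkStep α r q) - g x| ≤ C) : |walkOp α r g x - g x| ≤ C := by
  rw [walkOp_sub_self hd]
  calc _ ≤ ∑ q : Fin d × Bool, (1 / (2 * d) : ℝ) * C := by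
        refine Finset.abs_sum_le_sum_abs _ _ |>.trans (Finset.sum_le_sum fun q _ => ?_)
        rw [abs_mul, abs_of_nonneg (by positivity)]
        exact mul_le_mul_of_nonneg_left (h q) (by positivity)
    _ = C := by rw [← Finset.sum_mul, sum_walk_weights hd, one_mul]

theorem norm_walkStep_le (α : Matrix (Fin d) (Fin d) ℝ) {r : ℝ} (hr : 0 ≤ r) (q : Fin d × Bool) :
    ‖walkStep α r q‖ ≤ r * ∑ k, ‖column α k‖ := by
  have h : ‖walkStep α r q‖ = r * ‖column α q.1‖ := by
    unfold walkStep
    split_ifs <;> simp [norm_smul, abs_of_nonneg hr]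
  rw [h]
  exact mul_le_mul_of_nonneg_left
    (Finset.single_le_sum (f := fun k => ‖column α k‖) (fun k _ => norm_nonneg _)
      (Finset.mem_univ q.1)) hr

theorem HasLipschitzHessian.abs_generator_sub_le {α : Matrix (Fin d) (Fin d) ℝ} {K : ℝ}
    {g : E d → ℝ} (hg : HasLipschitzHessian K g) (x y : E d) :
    |generator α g x - generator α g y| ≤ K * (∑ k, ‖column α k‖ ^ 2) * ‖x - y‖ := by
  have hnn : 0 ≤ K * ‖x - y‖ := 
    (norm_nonneg (fderiv ℝ (fderiv ℝ g) x - fderiv ℝ (fderiv ℝ g) y)).trans (hg.lipschitz x y)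
  rw [generator_eq, generator_eq, ← sub_div, ← Finset.sum_sub_distrib, abs_div, abs_two]
  have h1 : |∑ k, (fderiv ℝ (fderiv ℝ g) x (column α k) (column α k) -
      fderiv ℝ (fderiv ℝ g) y (column α k) (column α k))| ≤
      ∑ k, K * ‖x - y‖ * ‖column α k‖ ^ 2 := by
    refine (Finset.abs_sum_le_sum_abs _ _).trans (Finset.sum_le_sum fun k _ => ?_)
    have h2 := ContinuousLinearMap.le_opNorm₂
      (fderiv ℝ (fderiv ℝ g) x - fderiv ℝ (fderiv ℝ g) y) (column α k) (column α k)
    have h3 := mul_le_mul_of_nonneg_right (hg.lipschitz x y) (sq_nonneg ‖column α k‖)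
    simp only [_root_.sub_apply, Real.norm_eq_abs] at h2
    rw [mul_assoc, ← sq] at h2
    exact h2.trans h3
  rw [← Finset.mul_sum] at h1
  have h4 : 0 ≤ K * ‖x - y‖ * ∑ k, ‖column α k‖ ^ 2 := by positivity
  linarith

/-- `Q` depends on `α` alone, not on `K`, `r` or `g`. This allows the step `r` to be chosen after
the smoothing, whose constant `K` may be large. -/
theorem exists_walkOp_consistency (hd : d ≠ 0) (α : Matrix (Fin d) (Fin d) ℝ) :
    ∃ Q : ℝ, 0 ≤ Q ∧ ∀ (K r : ℝ) (g : E d → ℝ), 0 ≤ K → 0 ≤ r → HasLipschitzHessian K g → ∀ x,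
      |walkOp α r g x - g x - r ^ 2 / d * generator α g x| ≤ r ^ 2 / d * (K * Q * r) ∧
      |generator α (walkOp α r g) x - generator α g x| ≤ K * Q * r := by
  have hd' : (0 : ℝ) < d := Nat.cast_pos.2 (Nat.pos_of_ne_zero hd)
  set S : ℝ := (∑ k, ‖column α k‖ ^ 2) * ∑ k, ‖column α k‖ with hS
  have hS0 : 0 ≤ S := by positivity
  have hT0 : 0 ≤ ∑ k, ‖column α k‖ ^ 3 := by positivity
  refine ⟨∑ k, ‖column α k‖ ^ 3 + S, by positivity, fun K r g hK hr hg x => ⟨?_, ?_⟩⟩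
  · have h1 : walkOp α r g x - g x - r ^ 2 / d * generator α g x =
        ∑ k, (1 / (2 * d) : ℝ) * (g (x + r • column α k) + g (x + -(r • column α k)) - 2 * g x
          - fderiv ℝ (fderiv ℝ g) x (r • column α k) (r • column α k)) := by
      rw [walkOp_sub_self hd, Fintype.sum_prod_type, generator_eq, Finset.sum_div, Finset.mul_sum,
        ← Finset.sum_sub_distrib]
      refine Finset.sum_congr rfl fun k _ => ?_
      simp only [Fintype.sum_bool, walkStep, if_true, map_smul, _root_.smul_apply,
        smul_eq_mul, Bool.false_eq_true, if_false]
      field_simp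
      ring
    rw [h1]
    calc _ ≤ ∑ k, (1 / (2 * d) : ℝ) * (2 * K * (r ^ 3 * ‖column α k‖ ^ 3)) := by
          refine (Finset.abs_sum_le_sum_abs _ _).trans (Finset.sum_le_sum fun k _ => ?_)
          rw [abs_mul, abs_of_nonneg (by positivity)]
          refine mul_le_mul_of_nonneg_left ?_ (by positivity)
          have := hg.abs_second_difference_le hK x (r • column α k)
          rwa [norm_smul, Real.norm_of_nonneg hr, mul_pow] at this
      _ = r ^ 2 / d * (K * (∑ k, ‖column α k‖ ^ 3) * r) := by
          rw [Finset.mul_sum, Finset.sum_mul, Finset.mul_sum]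
          refine Finset.sum_congr rfl fun k _ => ?_
          field_simp
      _ ≤ _ := by gcongr; linarith
  · rw [generator_walkOp hg.contDiff]
    refine abs_walkOp_sub_le hd fun q => (hg.abs_generator_sub_le _ _).trans ?_
    rw [add_sub_cancel_left]
    calc _ ≤ K * (∑ k, ‖column α k‖ ^ 2) * (r * ∑ k, ‖column α k‖) :=
          mul_le_mul_of_nonneg_left (norm_walkStep_le α hr q) (by positivity)
      _ = K * S * r := by rw [hS]; ring
      _ ≤ _ := by gcongr; linarith

end RandomWalk

end Corrector

/-! ### Comparison with the discrete heat flow and the smooth subsolution. -/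

namespace Corrector

variable {d : ℕ} {lam : Matrix (Fin (d + 1)) (Fin (d + 1)) ℝ} {α : Matrix (Fin d) (Fin d) ℝ}

theorem contDiff_norm_sq_linear (B : E d →ₗ[ℝ] E d) : ContDiff ℝ 2 fun y => ‖B y‖ ^ 2 :=
  (B.toContinuousLinearMap.contDiff (n := 2)).norm_sq ℝ

/-- One implicit time step of the comparison between a viscosity subsolution of
`-generator α u ≤ f` and smooth functions. -/
theorem le_of_implicit_step {u f V V' : E d → ℝ} (hu : UpperSemicontinuous u)
    (hsub : ∀ (φ : E d → ℝ) (x : E d), ContDiff ℝ 2 φ → IsLocalMax (fun y => u y - φ y) x →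
      0 ≤ f x + generator α φ x) (hV' : ContDiff ℝ 2 V') {h C : ℝ} (hh : 0 ≤ h)
    (hstep : ∀ x, V x + h * (generator α V' x + f x) ≤ V' x) (huV : ∀ x, u x ≤ V x)
    (hC : ∀ x, V x - V' x ≤ C) (x : E d) : u x ≤ V' x := by
  obtain ⟨c, hc, hgen⟩ := exists_generator_norm_sq_eq α LinearMap.id
  have hsq : ContDiff ℝ 2 fun y : E d => ‖(LinearMap.id : E d →ₗ[ℝ] E d) y‖ ^ 2 :=
    contDiff_norm_sq_linear _
  simp only [LinearMap.id_coe, id_eq] at hgen hsq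
  -- Since `u - V' ≤ V - V' ≤ C`, the penalty `δ‖x‖²` forces a maximum point. There the subsolution
  -- test combined with `hstep` gives `u ≤ V' + hδc`; then `δ` tends to `0`.
  have key : ∀ δ : ℝ, 0 < δ → u x ≤ V' x + δ * (‖x‖ ^ 2 + h * c) := by
    intro δ hδ
    have hφ : ContDiff ℝ 2 fun y => V' y + δ * ‖y‖ ^ 2 := hV'.add (contDiff_const.mul hsq)
    obtain ⟨R, hR⟩ := exists_forall_add_mul_sub_sq_le C 0 (u 0 - (V' 0 + δ * ‖(0 : E d)‖ ^ 2)) hδ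
    obtain ⟨y, -, hy⟩ := exists_isMaxOn_of_coercive (hu.sub_continuous hφ.continuous)
      isClosed_univ (Set.mem_univ 0) (R := R) fun z _ hz => by
        linarith [hR _ hz, hC z, huV z]
    have h1 := hsub _ y hφ (hy.isLocalMax univ_mem)
    rw [generator_add hV' (contDiff_const.mul hsq), generator_const_mul _ hsq, hgen] at h1
    have h2 : u x - (V' x + δ * ‖x‖ ^ 2) ≤ u y - (V' y + δ * ‖y‖ ^ 2) := hy (Set.mem_univ x)
    have h3 := hstep y
    have h4 := mul_nonneg hh h1
    have h5 : 0 ≤ δ * ‖y‖ ^ 2 := by positivity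
    linarith [huV y]
  refine le_of_forall_pos_le_add fun ε hε => ?_
  have hP : 0 < ‖x‖ ^ 2 + h * c + 1 := by positivity
  have h1 := key (ε / (‖x‖ ^ 2 + h * c + 1)) (by positivity)
  have h2 : ε / (‖x‖ ^ 2 + h * c + 1) * (‖x‖ ^ 2 + h * c) ≤ ε := by
    rw [div_mul_eq_mul_div, div_le_iff₀ hP]
    nlinarith
  linarith

/-- The growth constraint is stable under convex combinations of translates. -/
theorem walkOp_le_add {H : E d → ℝ} (hd : d ≠ 0) {r : ℝ} {g : E d → ℝ}
    (hg : ∀ x e, g (x + e) ≤ g x + H e) (x e : E d) :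
    walkOp α r g (x + e) ≤ walkOp α r g x + H e := by
  have h : walkOp α r g x + H e =
      ∑ q : Fin d × Bool, (1 / (2 * d) : ℝ) * (g (x + walkStep α r q) + H e) := by
    simp only [mul_add, Finset.sum_add_distrib, walkOp]
    rw [← Finset.sum_mul, sum_walk_weights hd, one_mul]
  rw [h]
  refine Finset.sum_le_sum fun q _ => mul_le_mul_of_nonneg_left ?_ (by positivity)
  have := hg (x + walkStep α r q) e
  rwa [add_right_comm] at this

theorem walkOp_iterate_regular {H : E d → ℝ} (hd : d ≠ 0) {r K : ℝ} {g : E d → ℝ}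
    (hg : HasLipschitzHessian K g) (hgH : ∀ x e, g (x + e) ≤ g x + H e) (n : ℕ) :
    HasLipschitzHessian K ((walkOp α r)^[n] g) ∧
      ∀ x e, (walkOp α r)^[n] g (x + e) ≤ (walkOp α r)^[n] g x + H e := by
  induction n with
  | zero => exact ⟨hg, hgH⟩
  | succ n ih =>
    rw [Function.iterate_succ_apply']
    exact ⟨ih.1.walkOp hd, walkOp_le_add hd ih.2⟩

theorem walkOp_sum (r : ℝ) (s : Finset ℕ) (c : ℝ) (g : ℕ → E d → ℝ) (x : E d) :
    walkOp α r (fun y => ∑ k ∈ s, c * g k y) x = ∑ k ∈ s, c * walkOp α r (g k) x := by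
  simp only [walkOp, Finset.mul_sum]
  rw [Finset.sum_comm]
  exact Finset.sum_congr rfl fun k _ => Finset.sum_congr rfl fun q _ => by ring

/-- A viscosity subsolution lies below the solution of the discretized heat equation. -/
theorem le_walkOp_iterate (hlam : ∀ i j, 0 ≤ lam i j) (hd : d ≠ 0) (B : E d →ₗ[ℝ] E d) {c : ℝ}
    (hc : 0 ≤ c) (hBc : ∀ x, generator α (fun y => ‖B y‖ ^ 2) x = c) {a K Q r : ℝ} (hK : 0 ≤ K)
    (hQ : 0 ≤ Q) (hr : 0 ≤ r)
    (hcons : ∀ g : E d → ℝ, HasLipschitzHessian K g → ∀ x,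
      |walkOp α r g x - g x - r ^ 2 / d * generator α g x| ≤ r ^ 2 / d * (K * Q * r) ∧
      |generator α (walkOp α r g) x - generator α g x| ≤ K * Q * r)
    {u g : E d → ℝ} (hu : UpperSemicontinuous u)
    (hsub : ∀ (φ : E d → ℝ) (x : E d), ContDiff ℝ 2 φ → IsLocalMax (fun y => u y - φ y) x →
      0 ≤ (‖B x‖ ^ 2 / 2 - a) + generator α φ x)
    (hg : HasLipschitzHessian K g) (hgH : ∀ x e, g (x + e) ≤ g x + deltaC lam e)
    (hug : ∀ x, u x ≤ g x) (n : ℕ) (x : E d) :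
    u x ≤ (walkOp α r)^[n] g x + n * (r ^ 2 / d) * (‖B x‖ ^ 2 / 2 - a)
      + ((n * (r ^ 2 / d)) ^ 2 * c + n * (r ^ 2 / d) * (2 * (K * Q * r))) := by
  set h : ℝ := r ^ 2 / d with hh
  have hh0 : 0 ≤ h := by positivity
  set ω : ℝ := K * Q * r with hω
  have hω0 : 0 ≤ ω := by positivity
  obtain ⟨M, hM0, hM⟩ := exists_deltaC_le_mul_norm hlam
  have hBC : ContDiff ℝ 2 fun y => ‖B y‖ ^ 2 := contDiff_norm_sq_linear B
  induction n generalizing x with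
  | zero => simpa using hug x
  | succ n ih =>
    obtain ⟨hG, hGH⟩ := walkOp_iterate_regular (α := α) (r := r) hd hg hgH n
    set G : E d → ℝ := (walkOp α r)^[n] g with hGdef
    rw [Function.iterate_succ_apply', ← hGdef]
    have hn : (0 : ℝ) ≤ n := n.cast_nonneg
    set T : ℝ := ((n + 1 : ℕ) : ℝ) * h with hT
    have hTn : T = n * h + h := by rw [hT]; push_cast; ring
    have hSC : ContDiff ℝ 2 (walkOp α r G) := (hG.walkOp hd).contDiff
    have hQC : ContDiff ℝ 2 fun y => T / 2 * ‖B y‖ ^ 2 := contDiff_const.mul hBC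
    have hrepr : ∀ y, walkOp α r G y + T * (‖B y‖ ^ 2 / 2 - a) + (T ^ 2 * c + T * (2 * ω)) =
        (walkOp α r G y + T / 2 * ‖B y‖ ^ 2) + (T ^ 2 * c + T * (2 * ω) - T * a) :=
      fun y => by ring
    have hgenV : ∀ y, generator α (fun y => walkOp α r G y + T * (‖B y‖ ^ 2 / 2 - a) +
        (T ^ 2 * c + T * (2 * ω))) y = generator α (walkOp α r G) y + T / 2 * c := by
      intro y
      rw [funext hrepr, generator_add_const, generator_add hSC hQC, generator_const_mul _ hBC, hBc]
    have hhc : 0 ≤ n * h * h * c := by positivity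
    have hhc' : 0 ≤ h * h * c := by positivity
    refine le_of_implicit_step (V' := fun y => walkOp α r G y + T * (‖B y‖ ^ 2 / 2 - a) +
        (T ^ 2 * c + T * (2 * ω))) (h := h)
      (C := r * (∑ k, ‖column α k‖) * M + h * |a|) hu hsub ?_ hh0 ?_ ih ?_ x
    · rw [funext hrepr]
      exact (hSC.add hQC).add contDiff_const
    · intro y
      rw [hgenV]
      -- One `ω` pays for replacing `PG - G` by `h` times the generator of `G`, the other for
      -- passing from `G` to `PG` inside the generator. The increment of `T²c` covers `h · Tc / 2`,
      -- the contribution of the quadratic term.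
      obtain ⟨h1, h2⟩ := hcons G hG y
      have h3 := (abs_le.1 h1).1
      have h4 := mul_le_mul_of_nonneg_left (abs_le.1 h2).2 hh0
      rw [hTn]
      nlinarith
    · intro y
      have h1 : |walkOp α r G y - G y| ≤ M * (r * ∑ k, ‖column α k‖) := by
        refine abs_walkOp_sub_le hd fun q => ?_
        have hw := mul_le_mul_of_nonneg_left (norm_walkStep_le α hr q) hM0
        have h2 := hGH y (walkStep α r q)
        have h3 := hGH (y + walkStep α r q) (-walkStep α r q)
        rw [add_neg_cancel_right] at h3
        have h4 := hM (walkStep α r q)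
        have h5 := hM (-walkStep α r q)
        rw [norm_neg] at h5
        exact abs_le.2 ⟨by linarith, by linarith⟩
      have h6 := (abs_le.1 h1).1
      have h7 : h * a ≤ h * |a| := mul_le_mul_of_nonneg_left (le_abs_self a) hh0
      have h8 : 0 ≤ h * ‖B y‖ ^ 2 := by positivity
      have h9 : 0 ≤ h * ω := by positivity
      rw [hTn]
      nlinarith

/-- A viscosity subsolution can be replaced by a smooth one, up to a small error. -/
theorem exists_smooth_subsolution (hlam : ∀ i j, 0 ≤ lam i j) (hd : d ≠ 0)
    (B : E d →ₗ[ℝ] E d) {a : ℝ} {u : E d → ℝ} (hu : UpperSemicontinuous u)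
    (hsub : ∀ (φ : E d → ℝ) (x : E d), ContDiff ℝ 2 φ → IsLocalMax (fun y => u y - φ y) x →
      0 ≤ (‖B x‖ ^ 2 / 2 - a) + generator α φ x)
    (huH : ∀ x e, u (x + e) ≤ u x + deltaC lam e) {ε : ℝ} (hε : 0 < ε) :
    ∃ W : E d → ℝ, ContDiff ℝ 2 W ∧ (∀ x e, W (x + e) ≤ W x + deltaC lam e) ∧
      ∀ x, a - ε ≤ ‖B x‖ ^ 2 / 2 + generator α W x := by
  obtain ⟨c, hc, hBc⟩ := exists_generator_norm_sq_eq α B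
  obtain ⟨Q, hQ, hcons⟩ := exists_walkOp_consistency hd α
  have hd' : (0 : ℝ) < d := Nat.cast_pos.2 (Nat.pos_of_ne_zero hd)
  set T : ℝ := ε / 3 / (c + 1) with hT
  have hT0 : 0 < T := by positivity
  have hTc : T * c ≤ ε / 3 := by
    rw [hT, div_mul_eq_mul_div, div_le_iff₀ (by positivity)]
    nlinarith
  -- The error carries a factor `T` because it is divided by `T` at the end. The order matters: `T`
  -- determines the accuracy, the accuracy determines `K`, and only then is `n` taken large, with
  -- `r` fixed by `n r²/d = T`.
  obtain ⟨K, g, hK, hg, hgH, hug⟩ := exists_smooth_approx hlam huH (ε := ε / 3 * T) (by positivity)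
  obtain ⟨n, hn0, r, hr, hnr, hω⟩ : ∃ n : ℕ, 0 < n ∧ ∃ r : ℝ, 0 < r ∧ n * (r ^ 2 / d) = T ∧
      3 * (K * Q * r) ≤ ε / 3 := by
    set r₀ : ℝ := ε / 3 / (3 * (K * Q) + 1) with hr₀
    have hr₀0 : 0 < r₀ := by positivity
    obtain ⟨n, hn⟩ := exists_nat_gt (T * d / r₀ ^ 2)
    have hn0 : (0 : ℝ) < n := lt_of_le_of_lt (by positivity) hn
    refine ⟨n, Nat.cast_pos.1 hn0, √(T * d / n), by positivity, ?_, ?_⟩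
    · rw [Real.sq_sqrt (by positivity)]
      field_simp
    · have h1 : √(T * d / n) ≤ r₀ := by
        rw [Real.sqrt_le_left hr₀0.le, div_le_iff₀ hn0]
        rw [div_lt_iff₀ (by positivity)] at hn
        linarith
      calc 3 * (K * Q * √(T * d / n)) ≤ (3 * (K * Q) + 1) * r₀ := by
            have h2 := mul_le_mul_of_nonneg_left h1 (by positivity : 0 ≤ 3 * (K * Q))
            linarith
        _ = ε / 3 := by rw [hr₀]; field_simp
  have hn' : (0 : ℝ) < n := Nat.cast_pos.2 hn0
  have hh0 : 0 < r ^ 2 / (d : ℝ) := by positivity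
  have hreg := walkOp_iterate_regular (α := α) (r := r) hd hg hgH
  have hw1 : ∑ _k ∈ Finset.range n, (1 / n : ℝ) = 1 := by
    rw [Finset.sum_const, Finset.card_range, nsmul_eq_mul]
    field_simp
  have hW : HasLipschitzHessian K fun x => ∑ k ∈ Finset.range n, (1 / n : ℝ) * (walkOp α r)^[k] g x :=
    HasLipschitzHessian.sum (fun _ _ => by positivity) hw1 fun k _ => (hreg k).1
  refine ⟨_, hW.contDiff, fun x e => ?_, fun x => ?_⟩
  · have h : ∑ k ∈ Finset.range n, (1 / n : ℝ) * (walkOp α r)^[k] g x + deltaC lam e =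
        ∑ k ∈ Finset.range n, (1 / n : ℝ) * ((walkOp α r)^[k] g x + deltaC lam e) := by
      simp only [mul_add, Finset.sum_add_distrib]
      rw [← Finset.sum_mul, hw1, one_mul]
    rw [h]
    exact Finset.sum_le_sum fun k _ => mul_le_mul_of_nonneg_left ((hreg k).2 x e) (by positivity)
  · have h1 := (abs_le.1 (hcons K r _ hK hr.le hW x).1).2
    have h2 : walkOp α r (fun x => ∑ k ∈ Finset.range n, (1 / n : ℝ) * (walkOp α r)^[k] g x) x -
        ∑ k ∈ Finset.range n, (1 / n : ℝ) * (walkOp α r)^[k] g x =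
        (1 / n : ℝ) * ((walkOp α r)^[n] g x - g x) := by
      rw [walkOp_sum, ← Finset.sum_sub_distrib]
      simp only [← mul_sub, ← Finset.mul_sum, ← Function.iterate_succ_apply' (walkOp α r)]
      rw [Finset.sum_range_sub fun k => (walkOp α r)^[k] g x]
      rfl
    rw [h2] at h1
    have h3 := le_walkOp_iterate hlam hd B hc hBc hK hQ hr.le
      (fun g hg x => hcons K r g hK hr.le hg x) hu hsub hg hgH (fun x => (hug x).1) n x
    rw [hnr] at h3
    have h4 := (hug x).2
    set γ : ℝ := generator α
      (fun x => ∑ k ∈ Finset.range n, (1 / n : ℝ) * (walkOp α r)^[k] g x) x with hγ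
    have h5 : (walkOp α r)^[n] g x - g x ≤ T * γ + T * (K * Q * r) := by
      have h6 := mul_le_mul_of_nonneg_left h1 hn'.le
      have h7 : (n : ℝ) * (1 / n * ((walkOp α r)^[n] g x - g x) - r ^ 2 / d * γ) =
          ((walkOp α r)^[n] g x - g x) - T * γ := by
        rw [← hnr]; field_simp
      rw [h7, ← mul_assoc, hnr] at h6
      linarith
    -- Of the three copies of `K * Q * r`, two come from the comparison with the flow and one from
    -- the consistency error of the averaged function. The three errors are at most `ε / 3` each.
    have h8 : 0 ≤ T * (γ + (‖B x‖ ^ 2 / 2 - a) + (ε / 3 + T * c + 3 * (K * Q * r))) := by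
      nlinarith
    have h9 := nonneg_of_mul_nonneg_right h8 hT0
    linarith

end Corrector

/-! ### Growth bounds and the comparison of eigenvalues. -/

namespace Corrector

variable {d : ℕ} {lam : Matrix (Fin (d + 1)) (Fin (d + 1)) ℝ}

theorem eventually_deltaC_ne_zero {w : E d → ℝ}
    (hw : Tendsto (fun ρ => w ρ / deltaC lam ρ) (Bornology.cobounded (E d)) (𝓝 1)) :
    ∀ᶠ ρ in Bornology.cobounded (E d), deltaC lam ρ ≠ 0 := by
  filter_upwards [hw.eventually (eventually_gt_nhds zero_lt_one)] with ρ hρ h0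
  simp [h0] at hρ

/-- The limit gives the bounds outside a ball, local boundedness and compactness inside it. -/
theorem exists_deltaC_bounds (hlam : ∀ i j, 0 ≤ lam i j) {w : E d → ℝ} (hb : LocBdd w)
    (hw : Tendsto (fun ρ => w ρ / deltaC lam ρ) (Bornology.cobounded (E d)) (𝓝 1)) {κ : ℝ}
    (hκ : 0 < κ) :
    ∃ C : ℝ, ∀ x, (1 - κ) * deltaC lam x - C ≤ w x ∧ w x ≤ (1 + κ) * deltaC lam x + C := by
  have hev : ∀ᶠ ρ in Bornology.cobounded (E d),
      (1 - κ) * deltaC lam ρ ≤ w ρ ∧ w ρ ≤ (1 + κ) * deltaC lam ρ := by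
    filter_upwards [eventually_deltaC_ne_zero hw,
      hw.eventually (eventually_gt_nhds (sub_lt_self 1 hκ)),
      hw.eventually (eventually_lt_nhds (lt_add_of_pos_right 1 hκ))] with ρ h0 h1 h2
    have hpos : 0 < deltaC lam ρ := (deltaC_nonneg hlam ρ).lt_of_ne' h0
    rw [lt_div_iff₀ hpos] at h1
    rw [div_lt_iff₀ hpos] at h2
    exact ⟨h1.le, h2.le⟩
  obtain ⟨R, -, hR⟩ := (hasBasis_cobounded_norm.eventually_iff).1 hev
  obtain ⟨N, hN⟩ := hb.exists_forall_norm_le |R|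
  obtain ⟨M, hM0, hM⟩ := exists_deltaC_le_mul_norm hlam
  have hC0 : 0 ≤ M * |R| := by positivity
  have hN0 : 0 ≤ N := (abs_nonneg _).trans (hN 0 (by simp))
  refine ⟨N + M * |R|, fun x => ?_⟩
  rcases le_total R ‖x‖ with hx | hx
  · have := hR hx
    exact ⟨by linarith [this.1], by linarith [this.2]⟩
  · have hx' : ‖x‖ ≤ |R| := hx.trans (le_abs_self R)
    have h1 := abs_le.1 (hN x hx')
    have h2 := (hM x).trans (mul_le_mul_of_nonneg_left hx' hM0)
    have h3 := mul_nonneg hκ.le (deltaC_nonneg hlam x)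
    have h4 := deltaC_nonneg hlam x
    exact ⟨by linarith, by linarith⟩

theorem inner_gradient_le {W : E d → ℝ} (hW : Differentiable ℝ W) {x e : E d} {c : ℝ}
    (h : ∀ s : ℝ, 0 ≤ s → W (x + s • e) ≤ W x + s * c) : inner ℝ (gradient W x) e ≤ c := by
  rw [gradient, InnerProductSpace.toDual_symm_apply]
  have hd := hasDerivAt_comp_line hW x e 0
  rw [zero_smul, add_zero] at hd
  refine le_of_tendsto hd.tendsto_slope_zero_right ?_
  filter_upwards [self_mem_nhdsWithin] with s hs
  have hs' : 0 < s := hs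
  have h1 := h s hs'.le
  rw [zero_add, zero_smul, add_zero, smul_eq_mul, inv_mul_le_iff₀ hs']
  linarith

theorem gradient_const_mul (τ : ℝ) {W : E d → ℝ} (hW : Differentiable ℝ W) (x : E d) :
    gradient (fun y => τ * W y) x = τ • gradient W x := by
  rw [gradient, fderiv_const_mul (hW x), map_smul, gradient]

theorem generator_nonneg_and_gradient_mem_polyC (hlam : ∀ i j, 0 ≤ lam i j)
    {σ α : Matrix (Fin d) (Fin d) ℝ} {a : ℝ}
    {φ : E d → ℝ} {x : E d} (h : correctorOp lam σ α a x (gradient φ x) (hessian φ x) ≤ 0) :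
    0 ≤ (‖Matrix.toEuclideanLin σ x‖ ^ 2 / 2 - a) + generator α φ x ∧
      gradient φ x ∈ polyC lam := by
  obtain ⟨h1, h2⟩ := correctorOp_nonpos_iff.1 h
  exact ⟨by unfold generator; linarith, mem_polyC_of_le hlam h2⟩

/-- The walk weights `1 / (2d)` do not sum to `1` when `d = 0`. The space is then a point and there
are no pairs `i ≠ j`, so testing with `0` compares the eigenvalues directly. -/
theorem eigenvalue_le_of_dim_zero {lam : Matrix (Fin (0 + 1)) (Fin (0 + 1)) ℝ}
    {σ α : Matrix (Fin 0) (Fin 0) ℝ} {a₁ a₂ : ℝ} {w₁ w₂ : E 0 → ℝ}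
    (h₁ : IsViscositySolution (correctorOp lam σ α a₁) w₁)
    (h₂ : IsViscositySolution (correctorOp lam σ α a₂) w₂) : a₁ ≤ a₂ := by
  have hs := h₁.2.1.2 0 0 contDiff_const
    (Eventually.of_forall fun y => by rw [Subsingleton.elim y 0])
  have hS := h₂.2.2.2 0 0 contDiff_const
    (Eventually.of_forall fun y => by rw [Subsingleton.elim y 0])
  have h1 := (correctorOp_nonpos_iff.1 hs).1
  rcases correctorOp_nonneg_iff.1 hS with h2 | ⟨i, j, hij, -⟩
  · exact h1.trans h2
  · exact absurd (Subsingleton.elim (α := Fin 1) i j) hij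

theorem eigenvalue_le (hlam : ∀ i j, 0 ≤ lam i j) {σ α : Matrix (Fin d) (Fin d) ℝ}
    {a₁ a₂ : ℝ} {w₁ w₂ : E d → ℝ}
    (h₁ : IsViscositySolution (correctorOp lam σ α a₁) w₁)
    (hw₁ : Tendsto (fun ρ => w₁ ρ / deltaC lam ρ) (Bornology.cobounded (E d)) (𝓝 1))
    (h₂ : IsViscositySolution (correctorOp lam σ α a₂) w₂)
    (hw₂ : Tendsto (fun ρ => w₂ ρ / deltaC lam ρ) (Bornology.cobounded (E d)) (𝓝 1)) :
    a₁ ≤ a₂ := by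
  rcases eq_or_ne d 0 with rfl | hd
  · exact eigenvalue_le_of_dim_zero h₁ h₂
  obtain ⟨hb₁, ⟨husc, hsub⟩, -⟩ := h₁
  obtain ⟨hb₂, -, hlsc, hsup⟩ := h₂
  have hδc := continuous_deltaC hlam
  have hpos : ∀ i j, i ≠ j → 0 < lam i j := fun i j hij =>
    lam_pos_of_eventually_deltaC_ne_zero hlam (eventually_deltaC_ne_zero hw₁) hij
  obtain ⟨m, hm, hmδ⟩ := exists_mul_norm_le_deltaC hpos hlam
  obtain ⟨M, hM0, hM⟩ := exists_deltaC_le_mul_norm hlam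
  obtain ⟨C₁, hC₁⟩ := exists_deltaC_bounds hlam hb₁ hw₁ one_pos
  have hgrow : ∀ x, upperEnv w₁ x ≤ C₁ + 2 * M * ‖x‖ := fun x =>
    upperEnv_le_of_le hb₁ (φ := fun x => C₁ + 2 * M * ‖x‖) (by fun_prop)
      (fun y => by linarith [(hC₁ y).2, hM y]) x
  have huH := le_add_deltaC_of_viscosity hlam husc (by positivity) hgrow
    fun φ x hφ hx => (generator_nonneg_and_gradient_mem_polyC hlam (hsub φ x hφ hx)).2
  have key : ∀ τ ε : ℝ, 0 < τ → τ < 1 → 0 < ε → τ * (a₁ - ε) ≤ a₂ := by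
    intro τ ε hτ0 hτ1 hε
    obtain ⟨W, hWC, hWH, hWL⟩ := exists_smooth_subsolution hlam hd (Matrix.toEuclideanLin σ) husc
      (fun φ x hφ hx => (generator_nonneg_and_gradient_mem_polyC hlam (hsub φ x hφ hx)).1) huH hε
    have hWd : Differentiable ℝ W := hWC.differentiable (by norm_num)
    have hτW : ContDiff ℝ 2 fun y => τ * W y := contDiff_const.mul hWC
    -- This choice gives `1 - κ = τ + κ`: the lower envelope of `w₂` beats `τW` by `κ δ_C`, which
    -- grows at least linearly, so the maximum below is attained.
    set κ : ℝ := (1 - τ) / 2 with hκ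
    have hκ0 : 0 < κ := by rw [hκ]; linarith
    obtain ⟨C₂, hC₂⟩ := exists_deltaC_bounds hlam hb₂ hw₂ hκ0
    have hlow : ∀ x, (1 - κ) * deltaC lam x - C₂ ≤ lowerEnv w₂ x :=
      le_lowerEnv_of_le hb₂ (φ := fun x => (1 - κ) * deltaC lam x - C₂) (by fun_prop)
        fun y => (hC₂ y).1
    have husc' : UpperSemicontinuous fun y => τ * W y - lowerEnv w₂ y := by
      simp only [sub_eq_add_neg]
      exact hτW.continuous.upperSemicontinuous.add hlsc.neg
    obtain ⟨y, -, hy⟩ := exists_isMaxOn_of_coercive husc' isClosed_univ (Set.mem_univ 0)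
      (R := (C₂ + τ * W 0 - (τ * W 0 - lowerEnv w₂ 0)) / (κ * m)) fun x _ hx => by
        have h1 := hWH 0 x
        rw [zero_add] at h1
        have h2 := mul_le_mul_of_nonneg_left h1 hτ0.le
        have h3 := hlow x
        have h4 := mul_le_mul_of_nonneg_left (hmδ x) hκ0.le
        rw [div_le_iff₀ (by positivity)] at hx
        have h5 : (1 - κ) * deltaC lam x = τ * deltaC lam x + κ * deltaC lam x := by
          rw [hκ]; ring
        linarith
    have hloc : IsLocalMin (fun x => lowerEnv w₂ x - τ * W x) y :=
      Eventually.of_forall fun x => by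
        have h : τ * W x - lowerEnv w₂ x ≤ τ * W y - lowerEnv w₂ y := hy (Set.mem_univ x)
        linarith
    rcases correctorOp_nonneg_iff.1 (hsup _ y hτW hloc) with h | ⟨i, j, hij, h⟩
    · have h1 : (α * α.transpose * hessian (fun y => τ * W y) y).trace / 2 =
          τ * generator α W y := generator_const_mul τ hWC y
      rw [h1] at h
      have h2 := mul_le_mul_of_nonneg_left (hWL y) hτ0.le
      have h3 : 0 ≤ (1 - τ) * (‖Matrix.toEuclideanLin σ y‖ ^ 2 / 2) :=
        mul_nonneg (by linarith) (by positivity)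
      linarith
    · exfalso
      -- An active constraint would give `λ^{i,j} ≤ τ λ^{i,j}`, impossible for a positive cost and
      -- `τ < 1`.
      rw [← inner_edge, gradient_const_mul τ hWd, real_inner_smul_right, real_inner_comm] at h
      have h1 : inner ℝ (gradient W y) (edge i j) ≤ lam i j :=
        inner_gradient_le hWd fun s hs =>
          (hWH y _).trans (by linarith [deltaC_smul_edge_le hlam hs i j])
      have h2 := mul_le_mul_of_nonneg_left h1 hτ0.le
      have h3 := mul_lt_mul_of_pos_right hτ1 (hpos i j hij)
      linarith
  have h1 : ∀ ε : ℝ, 0 < ε → a₁ - ε ≤ a₂ := by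
    intro ε hε
    have ht : Tendsto (fun τ : ℝ => τ * (a₁ - ε)) (𝓝[<] 1) (𝓝 (1 * (a₁ - ε))) :=
      ((continuous_id.mul continuous_const).tendsto 1).mono_left nhdsWithin_le_nhds
    rw [one_mul] at ht
    refine le_of_tendsto ht ?_
    filter_upwards [Ioo_mem_nhdsLT (zero_lt_one (α := ℝ))] with τ hτ using key τ ε hτ.1 hτ.2 hε
  exact le_of_forall_sub_le h1

end Corrector

theorem mainTheorem4 (d : ℕ) (lam : Matrix (Fin (d + 1)) (Fin (d + 1)) ℝ)
    (hlam : ∀ i j, 0 ≤ lam i j) (hdiag : ∀ i, lam i i = 0)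
    (σ α : Matrix (Fin d) (Fin d) ℝ) (a₁ a₂ : ℝ)
    (h₁ : ∃ w : Corrector.E d → ℝ,
      Corrector.IsViscositySolution (Corrector.correctorOp lam σ α a₁) w ∧
      Tendsto (fun ρ => w ρ / Corrector.deltaC lam ρ) (Bornology.cobounded (Corrector.E d)) (𝓝 1))
    (h₂ : ∃ w : Corrector.E d → ℝ,
      Corrector.IsViscositySolution (Corrector.correctorOp lam σ α a₂) w ∧
      Tendsto (fun ρ => w ρ / Corrector.deltaC lam ρ) (Bornology.cobounded (Corrector.E d)) (𝓝 1)) :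
    a₁ = a₂ := by
  obtain ⟨w₁, hs₁, ht₁⟩ := h₁
  obtain ⟨w₂, hs₂, ht₂⟩ := h₂
  exact le_antisymm (Corrector.eigenvalue_le hlam hs₁ ht₁ hs₂ ht₂)
    (Corrector.eigenvalue_le hlam hs₂ ht₂ hs₁ ht₁)
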